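/- Let $X=(X_1,\dots,X_N)$ and $Y=(Y_1,\dots,Y_N)$ be random variables with finite alphabets such that the pairs $(X_i,Y_i)$ are mutually independent, i.e. $P_{XY}(x,y)=\prod_{i=1}^N P_{X_iY_i}(x_i,y_i)$, where $X_i$ and $Y_i$ may be arbitrarily correlated. Let $C_1,\dots,C_K$ be sub-vectors of $Y$, let $\lambda_1,\dots,\lambda_K\ge 0$, let $\mu_i=\sum_{j:\,Y_i\in C_j}\lambda_j$, and let $\epsilon\ge 0$. All information quantities are in nats, and the disclosed variables $U$, $U_i$ range over all discrete (countable) alphabets. Put $$h_\epsilon^K(P_{XY})=\sup_{P_{U|X,Y}:\ I(X;U)\le\epsilon}\ \sum_{k=1}^K\lambda_k I(C_k;U),$$ $$\delta_i=\min\{I(X_i;Y_i)+H(X_i|Y_i),\ I(X_i;Y_i)+\log(I(X_i;Y_i)+1)+4\}\quad(1\le i\le N).$$ Then $$h_\epsilon^K(P_{XY})\ \le \sup_{\substack{\{P_{U_i|X_i,Y_i}\}_{i=1}^N:\\ \sum_i I(X_i;U_i)\le\epsilon}}\ \sum_{i=1}^N\mu_i\,(I(U_i;Y_i)+\delta_i)\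 =\sup_{\substack{\{P_{U_i|X_i,Y_i},\,\epsilon_i\}_{i=1}^N:\\ I(X_i;U_i)\le\epsilon_i,\ 0\le\epsilon_i\le\epsilon,\ \sum_i\epsilon_i\le\epsilon}}\ \sum_{i=1}^N\mu_i\,(I(U_i;Y_i)+\delta_i).$$ For fixed $\epsilon_1,\dots,\epsilon_N$ with $0\le\epsilon_i\le\epsilon$ and $\sum_i\epsilon_i\le\epsilon$, the last problem splits into $N$ parallel problems: $$\sup_{\substack{\{P_{U_i|X_i,Y_i}\}_{i=1}^N:\\ I(X_i;U_i)\le\epsilon_i}}\ \sum_{i=1}^N\mu_i\,(I(U_i;Y_i)+\delta_i)=\sum_{i=1}^N\mu_i\Big(\sup_{P_{U_i|X_i,Y_i}:\ I(X_i;U_i)\le\epsilon_i}I(U_i;Y_i)+\delta_i\Big).$$ The equality of the two suprema and this splitting hold with arbitrary real constants $d_i$ in place of $\delta_i$. Moreover, with the constants attached to the users, $$h_\epsilon^K(P_{XY})\ \le \sup_{\substack{\{P_{U_i|X_i,Y_i}\}_{i=1}^N:\\ \sum_i I(X_i;U_i)\le\epsilon}}\ \sum_{i=1}^N\mu_i\,I(U_i;Y_i)+\sum_{k=1}^K\lambda_k\min\Big\{\sum_{j:\,Y_j\in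 C_k}\big(I(X_j;Y_j)+H(X_j|Y_j)\big),\ \sum_{j:\,Y_j\in C_k}\big(I(X_j;Y_j)+\log(I(X_j;Y_j)+1)+4\big)\Big\}.$$ -/

import Mathlib

namespace PrivacyDesign

noncomputable section

/-- The mutual information `I(A;B)`, in nats, of two discrete random variables `A`, `B` on a
discrete probability space `(Ω, p)`:
`∑_{a,b} P(a,b) log (P(a,b) / (P(a) P(b)))`, with the convention `0 log 0 = 0`. -/
def mutualInfo {Ω α β : Type*} (p : PMF Ω) (A : Ω → α) (B : Ω → β) : ℝ :=
  ∑' c : α × β, ((p.map fun ω => (A ω, B ω)) c).toReal *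
    Real.log (((p.map fun ω => (A ω, B ω)) c).toReal /
      (((p.map A) c.1).toReal * ((p.map B) c.2).toReal))

/-- The conditional entropy `H(A|B)`, in nats, of random variables with finite alphabets:
`∑_{a,b} P(a,b) log (P(b) / P(a,b))`. -/
def condEntropy {Ω α β : Type*} [Fintype α] [Fintype β] (p : PMF Ω) (A : Ω → α) (B : Ω → β) : ℝ :=
  ∑ a : α, ∑ b : β, ((p.map fun ω => (A ω, B ω)) (a, b)).toReal *
    Real.log (((p.map B) b).toReal / ((p.map fun ω => (A ω, B ω)) (a, b)).toReal)

/-- A privacy mechanism `P_{U|X,Y}`: a countable alphabet for the disclosed data `U` and a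
conditional distribution of `U` given `(X,Y)`. -/
structure Mechanism (𝒳 𝒴 : Type*) where
  /-- the alphabet of `U` -/
  Out : Type
  /-- the alphabet is discrete -/
  countable_out : Countable Out
  /-- the conditional distribution of `U` given `(X,Y) = (x,y)` -/
  kernel : 𝒳 × 𝒴 → PMF Out

namespace Mechanism

variable {𝒳 𝒴 : Type*}

/-- The joint distribution of `((X,Y),U)`. -/
def joint (W : Mechanism 𝒳 𝒴) (P : PMF (𝒳 × 𝒴)) : PMF ((𝒳 × 𝒴) × W.Out) :=
  P.bind fun xy => (W.kernel xy).map fun u => (xy, u)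

/-- The leakage `I(X;U)`. -/
def leakage (W : Mechanism 𝒳 𝒴) (P : PMF (𝒳 × 𝒴)) : ℝ :=
  mutualInfo (W.joint P) (fun ω => ω.1.1) (fun ω => ω.2)

/-- The information `I(f(Y);U)` disclosed about a function `f(Y)` of the useful data. -/
def infoAbout {γ : Type*} (W : Mechanism 𝒳 𝒴) (P : PMF (𝒳 × 𝒴)) (f : 𝒴 → γ) : ℝ :=
  mutualInfo (W.joint P) (fun ω => f ω.1.2) (fun ω => ω.2)

/-- The utility `I(Y;U)`. -/
def utility (W : Mechanism 𝒳 𝒴) (P : PMF (𝒳 × 𝒴)) : ℝ :=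
  W.infoAbout P id

end Mechanism

/-- The single-component problem: the supremum of `I(Y;U)` over all `P_{U|X,Y}` with
`I(X;U) ≤ ε`. -/
def singleSup {𝒳 𝒴 : Type*} (P : PMF (𝒳 × 𝒴)) (ε : ℝ) : EReal :=
  ⨆ (W : Mechanism 𝒳 𝒴) (_ : W.leakage P ≤ ε), ((W.utility P : ℝ) : EReal)

section Components

variable {N K : ℕ} {𝒳 𝒴 : Fin N → Type*}

/-- The marginal distribution `P_{X_i,Y_i}`. -/
def marginal (P : PMF ((∀ i, 𝒳 i) × (∀ i, 𝒴 i))) (i : Fin N) : PMF (𝒳 i × 𝒴 i) :=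
  P.map fun xy => (xy.1 i, xy.2 i)

/-- The mutual information `I(X_i;Y_i)`. -/
def pairInfo (P : PMF ((∀ i, 𝒳 i) × (∀ i, 𝒴 i))) (i : Fin N) : ℝ :=
  mutualInfo P (fun xy => xy.1 i) (fun xy => xy.2 i)

/-- `I(X_i;Y_i) + H(X_i|Y_i)`. -/
def gap₁ [∀ i, Fintype (𝒳 i)] [∀ i, Fintype (𝒴 i)]
    (P : PMF ((∀ i, 𝒳 i) × (∀ i, 𝒴 i))) (i : Fin N) : ℝ :=
  pairInfo P i + condEntropy P (fun xy => xy.1 i) (fun xy => xy.2 i)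

/-- `I(X_i;Y_i) + log (I(X_i;Y_i) + 1) + 4`. -/
def gap₂ (P : PMF ((∀ i, 𝒳 i) × (∀ i, 𝒴 i))) (i : Fin N) : ℝ :=
  pairInfo P i + (Real.log (pairInfo P i + 1) + 4)

/-- The constant `δ_i` of the component `i`. -/
def compDelta [∀ i, Fintype (𝒳 i)] [∀ i, Fintype (𝒴 i)]
    (P : PMF ((∀ i, 𝒳 i) × (∀ i, 𝒴 i))) (i : Fin N) : ℝ :=
  min (gap₁ P i) (gap₂ P i)

/-- The corresponding constant of a user who demands the sub-vector `(Y_i)_{i ∈ s}`. -/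
def userDelta [∀ i, Fintype (𝒳 i)] [∀ i, Fintype (𝒴 i)]
    (P : PMF ((∀ i, 𝒳 i) × (∀ i, 𝒴 i))) (s : Finset (Fin N)) : ℝ :=
  min (∑ j ∈ s, gap₁ P j) (∑ j ∈ s, gap₂ P j)

/-- The weight `μ_i = ∑_{j : Y_i ∈ C_j} λ_j` of the component `i`; user `j` demands the components
in `C j`. -/
def weight (C : Fin K → Finset (Fin N)) (lam : Fin K → ℝ) (i : Fin N) : ℝ :=
  ∑ j : Fin K with i ∈ C j, lam j

/-- The privacy-utility trade-off `h_ε^K(P_XY)`: the supremum of `∑_k λ_k I(C_k;U)` over all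
`P_{U|X,Y}` with `I(X;U) ≤ ε`, where user `k` demands `C_k = (Y_i)_{i ∈ C k}`. -/
def tradeoff (P : PMF ((∀ i, 𝒳 i) × (∀ i, 𝒴 i))) (C : Fin K → Finset (Fin N))
    (lam : Fin K → ℝ) (ε : ℝ) : EReal :=
  ⨆ (W : Mechanism (∀ i, 𝒳 i) (∀ i, 𝒴 i)) (_ : W.leakage P ≤ ε),
    ((∑ k, lam k * W.infoAbout P (fun y => fun i : C k => y i) : ℝ) : EReal)

/-- `∑_i μ_i (I(U_i;Y_i) + d_i)` for a family of mechanisms `P_{U_i|X_i,Y_i}`. -/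
def objective (P : PMF ((∀ i, 𝒳 i) × (∀ i, 𝒴 i))) (C : Fin K → Finset (Fin N))
    (lam : Fin K → ℝ) (d : Fin N → ℝ) (W : ∀ i, Mechanism (𝒳 i) (𝒴 i)) : ℝ :=
  ∑ i, weight C lam i * ((W i).utility (marginal P i) + d i)

/-- The supremum of the objective under the joint constraint `∑_i I(X_i;U_i) ≤ ε`. -/
def jointSup (P : PMF ((∀ i, 𝒳 i) × (∀ i, 𝒴 i))) (C : Fin K → Finset (Fin N))
    (lam : Fin K → ℝ) (d : Fin N → ℝ) (ε : ℝ) : EReal :=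
  ⨆ (W : ∀ i, Mechanism (𝒳 i) (𝒴 i)) (_ : ∑ i, (W i).leakage (marginal P i) ≤ ε),
    ((objective P C lam d W : ℝ) : EReal)

/-- The supremum of the objective under fixed individual constraints `I(X_i;U_i) ≤ e_i`. -/
def fixedBudgetSup (P : PMF ((∀ i, 𝒳 i) × (∀ i, 𝒴 i))) (C : Fin K → Finset (Fin N))
    (lam : Fin K → ℝ) (d : Fin N → ℝ) (e : Fin N → ℝ) : EReal :=
  ⨆ (W : ∀ i, Mechanism (𝒳 i) (𝒴 i)) (_ : ∀ i, (W i).leakage (marginal P i) ≤ e i),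
    ((objective P C lam d W : ℝ) : EReal)

/-- `0 ≤ e_i ≤ ε` for all `i`, and `∑_i e_i ≤ ε`. -/
def IsBudget (ε : ℝ) (e : Fin N → ℝ) : Prop :=
  (∀ i, 0 ≤ e i ∧ e i ≤ ε) ∧ ∑ i, e i ≤ ε

/-- The supremum of the objective over all families of mechanisms and all budgets `e_i` with
`I(X_i;U_i) ≤ e_i`, `0 ≤ e_i ≤ ε` and `∑_i e_i ≤ ε`. -/
def budgetSup (P : PMF ((∀ i, 𝒳 i) × (∀ i, 𝒴 i))) (C : Fin K → Finset (Fin N))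
    (lam : Fin K → ℝ) (d : Fin N → ℝ) (ε : ℝ) : EReal :=
  ⨆ (e : Fin N → ℝ) (_ : IsBudget ε e), fixedBudgetSup P C lam d e

end Components

/-- The value of a distribution on pairs at `(a,b)` is at most that of its second marginal. -/
theorem map_pair_le_snd {Ω α β : Type*} (p : PMF Ω) (A : Ω → α) (B : Ω → β) (c : α × β) :
    ((p.map fun ω => (A ω, B ω)) c).toReal ≤ ((p.map B) c.2).toReal := by
  refine ENNReal.toReal_mono (PMF.apply_ne_top _ _) ?_
  classical
  rw [PMF.map_apply, PMF.map_apply]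
  refine ENNReal.tsum_le_tsum fun ω => ?_
  by_cases h : c = (A ω, B ω)
  · simp [h]
  · simp [h]

theorem map_pair_le_fst {Ω α β : Type*} (p : PMF Ω) (A : Ω → α) (B : Ω → β) (c : α × β) :
    ((p.map fun ω => (A ω, B ω)) c).toReal ≤ ((p.map A) c.1).toReal := by
  refine ENNReal.toReal_mono (PMF.apply_ne_top _ _) ?_
  classical
  rw [PMF.map_apply, PMF.map_apply]
  refine ENNReal.tsum_le_tsum fun ω => ?_
  by_cases h : c = (A ω, B ω)
  · simp [h]
  · simp [h]

/-- The series that defines `I(A;B)` converges absolutely as soon as `A` has a finite alphabet,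
so `mutualInfo` is a genuine sum wherever it is used here. -/
theorem summable_mutualInfo {Ω α β : Type*} [Finite α] (p : PMF Ω) (A : Ω → α) (B : Ω → β) :
    Summable fun c : α × β => ((p.map fun ω => (A ω, B ω)) c).toReal *
      Real.log (((p.map fun ω => (A ω, B ω)) c).toReal /
        (((p.map A) c.1).toReal * ((p.map B) c.2).toReal)) := by
  classical
  have := Fintype.ofFinite α
  have hsumβ : Summable fun b => ((p.map B) b).toReal :=
    ENNReal.summable_toReal (by rw [PMF.tsum_coe]; exact ENNReal.one_ne_top)
  have hsumA : Summable fun a => ((p.map A) a).toReal := (hasSum_fintype _).summable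
  have hprod : Summable fun c : α × β => ((p.map A) c.1).toReal * ((p.map B) c.2).toReal :=
    hsumA.mul_of_nonneg hsumβ (fun _ => ENNReal.toReal_nonneg) (fun _ => ENNReal.toReal_nonneg)
  have hpair : Summable fun c : α × β => ((p.map fun ω => (A ω, B ω)) c).toReal :=
    ENNReal.summable_toReal (by rw [PMF.tsum_coe]; exact ENNReal.one_ne_top)
  set M : ℝ := ∑ a, |Real.log ((p.map A) a).toReal| with hM
  refine Summable.of_norm_bounded
    (g := fun c : α × β => ((p.map fun ω => (A ω, B ω)) c).toReal * M +
      (((p.map A) c.1).toReal * ((p.map B) c.2).toReal))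
    ((hpair.mul_right M).add hprod) ?_
  intro c
  have h1 := map_pair_le_fst p A B c
  have h2 := map_pair_le_snd p A B c
  have hMc : |Real.log ((p.map A) c.1).toReal| ≤ M :=
    Finset.single_le_sum (f := fun a => |Real.log ((p.map A) a).toReal|)
      (fun a _ => abs_nonneg _) (Finset.mem_univ c.1)
  have h0 : 0 ≤ ((p.map fun ω => (A ω, B ω)) c).toReal := ENNReal.toReal_nonneg
  generalize ((p.map fun ω => (A ω, B ω)) c).toReal = r at h0 h1 h2 ⊢
  generalize ((p.map A) c.1).toReal = s at h1 hMc ⊢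
  generalize ((p.map B) c.2).toReal = t at h2 ⊢
  have hM0 : 0 ≤ M := (abs_nonneg _).trans hMc
  rcases h0.eq_or_lt with rfl | hr
  · simp only [zero_mul, norm_zero, zero_add]
    positivity
  have hs : 0 < s := hr.trans_le h1
  have ht : 0 < t := hr.trans_le h2
  have hup : Real.log (r / (s * t)) ≤ M := by
    rw [Real.log_div hr.ne' (by positivity), Real.log_mul hs.ne' ht.ne']
    have := Real.log_le_log hr h2
    have := neg_le_abs (Real.log s)
    linarith
  have hlow : 1 - s * t / r ≤ Real.log (r / (s * t)) := by
    have := Real.one_sub_inv_le_log_of_pos (x := r / (s * t)) (by positivity)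
    rwa [inv_div] at this
  have hlow' : r - s * t ≤ r * Real.log (r / (s * t)) := by
    have := mul_le_mul_of_nonneg_left hlow hr.le
    have e : r * (1 - s * t / r) = r - s * t := by field_simp
    linarith
  rw [Real.norm_eq_abs, abs_le]
  constructor
  · nlinarith [mul_nonneg hr.le hM0]
  · nlinarith [mul_le_mul_of_nonneg_left hup hr.le, mul_pos hs ht]

end

end PrivacyDesign

/-!
The privacy constraint can be met without any leakage at almost no loss. For one pair `(X, Y)`,
disclose a random function `g : 𝒳 → 𝒴` that is independent of `X`, is such that `g x` has law
`P_{Y|X=x}`, and is coupled to the data by `Y = g(X)`. Then `I(X;g) = 0` and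
`I(Y;g) = H(Y) - H(g(X)|g)`. The last term is at most `H(X) = I(X;Y) + H(X|Y)`, because `g(X)` is a
function of `X` once `g` is known. For a good choice of `g` it is also at most
`I(X;Y) + log (I(X;Y) + 1) + 2`, a form of the strong functional representation lemma
(`exists_random_function`). Hence `H(Y_i) ≤ I(Y_i;U_i) + δ_i` for a single mechanism with
`I(X_i;U_i) = 0` (`exists_mechanism_leakage_eq_zero`), whereas any mechanism gives user `k` at most
`H(C_k) ≤ ∑_{j ∈ C_k} H(Y_j)` (`tradeoff_le`). Exchanging the sums over users and components yields
both bounds.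

The random function comes from an exponential race. Take independent clocks `ω y ∼ Exp(1)` and let
`g x` be the letter that minimizes `ω y / p(y|x)`. The winner `y` has law `p(·|x)`, and given the
winner, `ω y / p(y|x)` is again `Exp(1)` (`lintegral_winSet`). With `q = P_Y`, code the letter `y`
by the weight `(1 + ω y / q(y))^{-(a+1)}`, which depends on the clocks but not on `x`. The
normalization costs about `-log a`, since the mean of the total weight is at most `1 / a`. The
arrival time `ω y / q(y)` of the winner has conditional mean `r = p(y|x) / q(y)`, so its cost
`(a + 1) log (1 + ω y / q(y))` is at most `(a + 1) log (1 + r)` in mean, by concavity. As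
`E log (1 + r) ≤ I + 1`, the choice `a = 1 / (I + 1)` gives the total `I + log (I + 1) + 2`.

The equality of the two suprema follows by taking the leakages themselves, which are nonnegative,
as budgets. The splitting holds because the constraints do not interact and every single-component
supremum is finite, lying between the utility of a leakage-free mechanism and `H(Y_i)`.
-/

open MeasureTheory ProbabilityTheory Set Filter Topology
open scoped ENNReal

namespace PrivacyDesign

noncomputable section

/-! ### Integrals against the exponential law -/

theorem lintegral_expMeasure_one {f : ℝ → ℝ≥0∞} (hf : Measurable f) :
    ∫⁻ u, f u ∂expMeasure 1 = ∫⁻ u in Ioi 0, ENNReal.ofReal (Real.exp (-u)) * f u := by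
  have hm : Measurable (exponentialPDF 1) := (measurable_exponentialPDFReal 1).ennreal_ofReal
  have h : ∫⁻ u, f u ∂expMeasure 1 = ∫⁻ u, exponentialPDF 1 u * f u :=
    lintegral_withDensity_eq_lintegral_mul _ hm hf
  rw [h, ← lintegral_indicator measurableSet_Ioi]
  refine lintegral_congr_ae ?_
  filter_upwards [Measure.ae_ne volume (0 : ℝ)] with u hu
  rcases lt_or_gt_of_ne hu with h0 | h0
  · rw [exponentialPDF_of_neg h0, indicator_of_notMem (by simpa using h0.le), zero_mul]
  · rw [exponentialPDF_of_nonneg h0.le, indicator_of_mem (by simpa using h0)]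
    simp

theorem expMeasure_one_Ioi {t : ℝ} (ht : 0 ≤ t) :
    expMeasure 1 (Ioi t) = ENNReal.ofReal (Real.exp (-t)) := by
  have := isProbabilityMeasure_expMeasure (r := 1) one_pos
  rw [← compl_Iic, prob_compl_eq_one_sub measurableSet_Iic,
    ← ENNReal.ofReal_toReal (measure_ne_top _ (Iic t)), ← measureReal_def, ← cdf_eq_real,
    cdf_expMeasure_eq one_pos, if_pos ht, ← ENNReal.ofReal_one, ← ENNReal.ofReal_sub]
  · simp
  · simpa using ht

theorem lintegral_exp_neg_div {p : ℝ} (hp : 0 < p) :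
    ∫⁻ u in Ioi 0, ENNReal.ofReal (Real.exp (-(u / p))) = ENNReal.ofReal p := by
  have h := Real.integral_rpow_mul_exp_neg_mul_Ioi (a := 1) (r := 1 / p) one_pos (by positivity)
  have h' : ∫ u in Ioi (0 : ℝ), Real.exp (-(u / p)) = p := by
    simpa [div_eq_inv_mul] using h
  rw [← ofReal_integral_eq_lintegral_ofReal, h']
  · exact Integrable.of_integral_ne_zero (by rw [h']; exact hp.ne')
  · exact Eventually.of_forall fun u => (Real.exp_pos _).le

theorem lintegral_exp_neg_div_mul_self {p : ℝ} (hp : 0 < p) :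
    ∫⁻ u in Ioi 0, ENNReal.ofReal (Real.exp (-(u / p))) * ENNReal.ofReal u =
      ENNReal.ofReal (p * p) := by
  have h := Real.integral_rpow_mul_exp_neg_mul_Ioi (a := 2) (r := 1 / p) two_pos (by positivity)
  have h' : ∫ u in Ioi (0 : ℝ), Real.exp (-(u / p)) * u = p * p := by
    have e : (2 : ℝ) - 1 = 1 := by norm_num
    simpa [div_eq_inv_mul, e, mul_comm, sq] using h
  have h'' : ∫⁻ u in Ioi (0 : ℝ), ENNReal.ofReal (Real.exp (-(u / p)) * u) =
      ENNReal.ofReal (p * p) := by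
    rw [← ofReal_integral_eq_lintegral_ofReal, h']
    · exact Integrable.of_integral_ne_zero (by rw [h']; positivity)
    · refine (ae_restrict_iff' measurableSet_Ioi).2 (Eventually.of_forall fun u hu => ?_)
      exact mul_nonneg (Real.exp_pos _).le (le_of_lt hu)
  rw [← h'']
  exact lintegral_congr fun u => (ENNReal.ofReal_mul (Real.exp_pos _).le).symm

/-- The density `e^{-u}` is dropped here: `∫₀^∞ (1 + u / q)^{-(a+1)} du = q / a`. Summed over the
letters, with `q` their probabilities, these bounds give `1 / a`. -/
theorem lintegral_rpow_weight_le {q a : ℝ} (hq : 0 < q) (ha : 0 < a) :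
    ∫⁻ u, ENNReal.ofReal ((1 + u / q) ^ (-(a + 1))) ∂expMeasure 1 ≤ ENNReal.ofReal (q / a) := by
  have hcont : ContinuousWithinAt (fun u : ℝ => -(q / a) * (1 + u / q) ^ (-a)) (Ici 0) 0 := by
    refine ContinuousAt.continuousWithinAt ?_
    refine continuousAt_const.mul (ContinuousAt.rpow_const (by fun_prop) (Or.inl (by simp)))
  have hderiv : ∀ u ∈ Ioi (0 : ℝ), HasDerivAt (fun u : ℝ => -(q / a) * (1 + u / q) ^ (-a))
      ((1 + u / q) ^ (-(a + 1))) u := by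
    intro u hu
    have hu : 0 < u := hu
    have h1 : HasDerivAt (fun u : ℝ => 1 + u / q) (1 / q) u :=
      ((hasDerivAt_id u).div_const q).const_add 1
    have h2 := (h1.rpow_const (p := -a) (Or.inl (by positivity))).const_mul (-(q / a))
    refine h2.congr_deriv ?_
    rw [show -a - 1 = -(a + 1) by ring]
    field_simp
  have hnonneg : ∀ u ∈ Ioi (0 : ℝ), 0 ≤ (1 + u / q) ^ (-(a + 1)) := by
    intro u hu
    have hu : 0 < u := hu
    positivity
  have hlim : Tendsto (fun u : ℝ => -(q / a) * (1 + u / q) ^ (-a)) atTop (𝓝 0) := by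
    have h1 : Tendsto (fun u : ℝ => 1 + u / q) atTop atTop :=
      tendsto_atTop_add_const_left _ _ (tendsto_id.atTop_div_const hq)
    simpa using ((tendsto_rpow_neg_atTop ha).comp h1).const_mul (-(q / a))
  have hint := integral_Ioi_of_hasDerivAt_of_nonneg hcont hderiv hnonneg hlim
  have hint' : ∫ u in Ioi (0 : ℝ), (1 + u / q) ^ (-(a + 1)) = q / a := by
    rw [hint]; simp
  have hmeas : Measurable fun u : ℝ => ENNReal.ofReal ((1 + u / q) ^ (-(a + 1))) := by
    fun_prop
  rw [lintegral_expMeasure_one hmeas, ← hint', ofReal_integral_eq_lintegral_ofReal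
    (integrableOn_Ioi_deriv_of_nonneg hcont hderiv hnonneg hlim)
    ((ae_restrict_iff' measurableSet_Ioi).2 (Eventually.of_forall hnonneg))]
  refine setLIntegral_mono' measurableSet_Ioi fun u hu => ?_
  have hu : 0 < u := hu
  calc _ ≤ 1 * ENNReal.ofReal ((1 + u / q) ^ (-(a + 1))) := by
        gcongr
        rw [← ENNReal.ofReal_one]
        exact ENNReal.ofReal_le_ofReal (by simpa using hu.le)
    _ = _ := one_mul _

/-! ### The exponential race -/

variable {𝒴 : Type*} [Fintype 𝒴]

/-- Independent exponential clocks of rate one, indexed by `𝒴`. -/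
def clocks (𝒴 : Type*) [Fintype 𝒴] : Measure (𝒴 → ℝ) := Measure.pi fun _ => expMeasure 1

instance isProbabilityMeasure_clocks : IsProbabilityMeasure (clocks 𝒴) := by
  have := isProbabilityMeasure_expMeasure (r := 1) one_pos
  unfold clocks
  infer_instance

/-- The event that `y` wins the race with rates `p`: `ω y / p y` is the strict minimum of the
`ω z / p z`. Letters of rate zero never win. -/
def winSet (p : 𝒴 → ℝ) (y : 𝒴) : Set (𝒴 → ℝ) :=
  {ω | 0 < p y ∧ ∀ z, z ≠ y → p z * ω y < p y * ω z}

theorem measurableSet_winSet (p : 𝒴 → ℝ) (y : 𝒴) : MeasurableSet (winSet p y) := by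
  have : winSet p y = {_ω | 0 < p y} ∩ {ω | ∀ z, z ≠ y → p z * ω y < p y * ω z} := rfl
  rw [this, ofPred_forall]
  refine (MeasurableSet.const _).inter ?_
  refine MeasurableSet.iInter fun z => ?_
  rw [ofPred_forall]
  exact MeasurableSet.iInter fun _ => measurableSet_lt (by fun_prop) (by fun_prop)

omit [Fintype 𝒴] in
theorem winSet_disjoint (p : 𝒴 → ℝ) {y z : 𝒴} (h : y ≠ z) {ω : 𝒴 → ℝ} (hy : ω ∈ winSet p y) :
    ω ∉ winSet p z := fun hz => lt_asymm (hy.2 z h.symm) (hz.2 y h)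

/-- On the event that `y` wins, the clock `ω y` has the density `e^{-u / p y}`: the factor `e^{-u}` of
the clock itself is multiplied by `∏_{z ≠ y} e^{-p z u / p y}`, the probability that all others are
later. In particular `y` wins with probability `p y`. -/
theorem lintegral_winSet {p : 𝒴 → ℝ} (hp : ∀ y, 0 ≤ p y) (hp1 : ∑ y, p y = 1) {y : 𝒴}
    (hy : 0 < p y) {f : ℝ → ℝ≥0∞} (hf : Measurable f) :
    ∫⁻ ω in winSet p y, f (ω y) ∂clocks 𝒴 =
      ∫⁻ u in Ioi 0, ENNReal.ofReal (Real.exp (-(u / p y))) * f u := by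
  classical
  have := isProbabilityMeasure_expMeasure (r := 1) one_pos
  set S : Set (({i // i = y} → ℝ) × ({i // ¬ i = y} → ℝ)) :=
    {v | ∀ z : {i // ¬ i = y}, p z * v.1 ⟨y, rfl⟩ < p y * v.2 z} with hS
  have hSm : MeasurableSet S := by
    rw [hS, ofPred_forall]
    exact MeasurableSet.iInter fun z => measurableSet_lt (by fun_prop) (by fun_prop)
  have hFm : Measurable (S.indicator fun v => f (v.1 ⟨y, rfl⟩)) :=
    Measurable.indicator (by fun_prop) hSm
  have hmp := measurePreserving_piEquivPiSubtypeProd (fun _ : 𝒴 => expMeasure 1) (· = y)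
  rw [← lintegral_indicator (measurableSet_winSet p y)]
  have h1 : ∀ ω : 𝒴 → ℝ, (winSet p y).indicator (fun ω => f (ω y)) ω =
      S.indicator (fun v => f (v.1 ⟨y, rfl⟩))
        (MeasurableEquiv.piEquivPiSubtypeProd (fun _ => ℝ) (· = y) ω) := by
    intro ω
    have : ω ∈ winSet p y ↔
        MeasurableEquiv.piEquivPiSubtypeProd (fun _ => ℝ) (· = y) ω ∈ S := by
      simp [winSet, hS, hy, MeasurableEquiv.piEquivPiSubtypeProd, Equiv.piEquivPiSubtypeProd]
    by_cases h : ω ∈ winSet p y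
    · rw [indicator_of_mem h, indicator_of_mem (this.1 h)]
      rfl
    · rw [indicator_of_notMem h, indicator_of_notMem (fun h' => h (this.2 h'))]
  simp_rw [h1]
  unfold clocks
  rw [hmp.lintegral_comp hFm, lintegral_prod _ hFm.aemeasurable]
  set G : ℝ → ℝ≥0∞ := fun u =>
    f u * ∏ z : {i // ¬ i = y}, expMeasure 1 (Ioi (p z * u / p y)) with hG
  have h2 : ∀ v : {i // i = y} → ℝ,
      ∫⁻ w, S.indicator (fun v => f (v.1 ⟨y, rfl⟩)) (v, w) ∂(Measure.pi fun _ => expMeasure 1) =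
        G (v ⟨y, rfl⟩) := by
    intro v
    rw [hG]
    dsimp only
    rw [← Measure.pi_pi, ← lintegral_indicator_const
      (MeasurableSet.univ_pi fun _ => measurableSet_Ioi)]
    refine lintegral_congr fun w => ?_
    have : (v, w) ∈ S ↔ w ∈ univ.pi fun z : {i // ¬ i = y} => Ioi (p z * v ⟨y, rfl⟩ / p y) := by
      simp only [hS, mem_ofPred_eq, Set.mem_pi, mem_univ, true_imp_iff, mem_Ioi, div_lt_iff₀ hy,
        mul_comm (p y)]
    by_cases h : (v, w) ∈ S
    · rw [indicator_of_mem h, indicator_of_mem (this.1 h)]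
    · rw [indicator_of_notMem h, indicator_of_notMem (fun h' => h (this.2 h'))]
  have hGm : Measurable G := by
    refine hf.mul (Finset.measurable_prod _ fun z _ => ?_)
    have : Antitone fun u : ℝ => expMeasure 1 (Ioi (p z * u / p y)) := by
      intro u v huv
      refine measure_mono (Ioi_subset_Ioi ?_)
      have := hp z
      gcongr
    exact this.measurable
  refine (lintegral_congr h2).trans ?_
  calc _ = ∫⁻ u, G u ∂expMeasure 1 := by
        refine MeasurePreserving.lintegral_comp (g := fun v : {i // i = y} → ℝ => v ⟨y, rfl⟩) ?_ hGm
        convert measurePreserving_eval (fun _ : {i // i = y} => expMeasure 1) ⟨y, rfl⟩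
    _ = _ := lintegral_expMeasure_one hGm
    _ = _ := by
      refine setLIntegral_congr_fun measurableSet_Ioi fun u hu => ?_
      have hu : 0 < u := hu
      have h4 : ∏ z : {i // ¬ i = y}, expMeasure 1 (Ioi (p z * u / p y)) =
          ENNReal.ofReal (Real.exp (-((1 - p y) * u / p y))) := by
        have h5 (z : {i // ¬ i = y}) : expMeasure 1 (Ioi (p z * u / p y)) =
            ENNReal.ofReal (Real.exp (-(p z * u / p y))) :=
          expMeasure_one_Ioi (div_nonneg (mul_nonneg (hp z) hu.le) hy.le)
        rw [Finset.prod_congr rfl fun z _ => h5 z,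
          ← ENNReal.ofReal_prod_of_nonneg fun _ _ => (Real.exp_pos _).le, ← Real.exp_sum]
        congr 2
        rw [Finset.sum_neg_distrib, ← Finset.sum_div, ← Finset.sum_mul]
        have h6 : ∑ z : {i // ¬ i = y}, p z = 1 - p y := by
          rw [← hp1, ← Finset.sum_erase_eq_sub (Finset.mem_univ y)]
          exact (Finset.sum_subtype (Finset.univ.erase y) (by simp) p).symm
        rw [h6]
      simp only [hG, h4]
      rw [mul_comm (f u), ← mul_assoc, ← ENNReal.ofReal_mul (Real.exp_pos _).le, ← Real.exp_add]
      congr 3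
      field_simp
      ring

section Race

variable {𝒴 : Type*} [Fintype 𝒴]

omit [Fintype 𝒴] in
theorem winSet_eq_empty {p : 𝒴 → ℝ} {y : 𝒴} (hy : p y ≤ 0) : winSet p y = ∅ :=
  eq_empty_of_forall_notMem fun _ hω => (hω.1.trans_le hy).false

theorem clocks_winSet {p : 𝒴 → ℝ} (hp : ∀ y, 0 ≤ p y) (hp1 : ∑ y, p y = 1) (y : 𝒴) :
    clocks 𝒴 (winSet p y) = ENNReal.ofReal (p y) := by
  rcases (hp y).eq_or_lt with hy | hy
  · rw [winSet_eq_empty hy.ge, ← hy]; simp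
  · rw [← lintegral_exp_neg_div hy]
    simpa using lintegral_winSet hp hp1 hy (f := fun _ => 1) measurable_const

theorem ae_clocks_pos : ∀ᵐ ω ∂clocks 𝒴, ∀ y, 0 < ω y := by
  have := isProbabilityMeasure_expMeasure (r := 1) one_pos
  refine ae_all_iff.2 fun y => ?_
  have h : ∀ᵐ u ∂expMeasure 1, 0 < u := by
    refine (mem_ae_iff_prob_eq_one measurableSet_Ioi).2 ?_
    simpa using expMeasure_one_Ioi le_rfl
  exact (measurePreserving_eval (fun _ : 𝒴 => expMeasure 1) y).quasiMeasurePreserving.ae h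

/-- There is almost surely a winner, because the winning probabilities add up to one. -/
theorem ae_exists_winSet {p : 𝒴 → ℝ} (hp : ∀ y, 0 ≤ p y) (hp1 : ∑ y, p y = 1) :
    ∀ᵐ ω ∂clocks 𝒴, ∃ y, ω ∈ winSet p y := by
  have h : clocks 𝒴 (⋃ y, winSet p y) = 1 := by
    rw [measure_iUnion (fun y z hyz => disjoint_left.2 fun ω hω => winSet_disjoint p hyz hω)
      (fun y => measurableSet_winSet p y), tsum_fintype,
      Finset.sum_congr rfl fun y _ => clocks_winSet hp hp1 y,
      ← ENNReal.ofReal_sum_of_nonneg fun y _ => hp y, hp1, ENNReal.ofReal_one]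
  have h' := (prob_compl_eq_zero_iff (MeasurableSet.iUnion fun y => measurableSet_winSet p y)).2 h
  filter_upwards [measure_eq_zero_iff_ae_notMem.1 h'] with ω hω
  simpa using hω

theorem setLIntegral_winSet_self {p : 𝒴 → ℝ} (hp : ∀ y, 0 ≤ p y) (hp1 : ∑ y, p y = 1) (y : 𝒴) :
    ∫⁻ ω in winSet p y, ENNReal.ofReal (ω y) ∂clocks 𝒴 = ENNReal.ofReal (p y * p y) := by
  rcases (hp y).eq_or_lt with hy | hy
  · rw [winSet_eq_empty hy.ge, ← hy]; simp
  · rw [lintegral_winSet hp hp1 hy ENNReal.measurable_ofReal, lintegral_exp_neg_div_mul_self hy]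

theorem integrableOn_winSet_self {p : 𝒴 → ℝ} (hp : ∀ y, 0 ≤ p y) (hp1 : ∑ y, p y = 1) (y : 𝒴) :
    IntegrableOn (fun ω => ω y) (winSet p y) (clocks 𝒴) := by
  refine ⟨(measurable_pi_apply y).aestronglyMeasurable, ?_⟩
  rw [hasFiniteIntegral_iff_ofReal
    (ae_restrict_of_ae (ae_clocks_pos.mono fun ω hω => (hω y).le)),
    setLIntegral_winSet_self hp hp1]
  exact ENNReal.ofReal_lt_top

theorem integrable_winSet_affine {p : 𝒴 → ℝ} (hp : ∀ y, 0 ≤ p y) (hp1 : ∑ y, p y = 1) (y : 𝒴)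
    (a b : ℝ) :
    Integrable ((winSet p y).indicator fun ω => a + b * ω y) (clocks 𝒴) := by
  rw [integrable_indicator_iff (measurableSet_winSet p y)]
  exact (integrable_const a).integrableOn.add ((integrableOn_winSet_self hp hp1 y).const_mul b)

theorem integral_winSet_affine {p : 𝒴 → ℝ} (hp : ∀ y, 0 ≤ p y) (hp1 : ∑ y, p y = 1) (y : 𝒴)
    (a b : ℝ) :
    ∫ ω, (winSet p y).indicator (fun ω => a + b * ω y) ω ∂clocks 𝒴 =
      a * p y + b * (p y * p y) := by
  rw [integral_indicator (measurableSet_winSet p y),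
    integral_add (integrable_const a).integrableOn
      ((integrableOn_winSet_self hp hp1 y).const_mul b),
    integral_const_mul, setIntegral_const, measureReal_def, clocks_winSet hp hp1,
    ENNReal.toReal_ofReal (hp y), integral_eq_lintegral_of_nonneg_ae
      (ae_restrict_of_ae (ae_clocks_pos.mono fun ω hω => (hω y).le))
      (measurable_pi_apply y).aestronglyMeasurable, setLIntegral_winSet_self hp hp1,
    ENNReal.toReal_ofReal (mul_self_nonneg _), smul_eq_mul, mul_comm a]

/-- `(1 + t)^{-(a+1)}`, evaluated at the arrival time `t = ω y / q` of the letter `y`. -/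
def arrivalWeight (q a : ℝ) (y : 𝒴) (ω : 𝒴 → ℝ) : ℝ := (1 + ω y / q) ^ (-(a + 1))

theorem lintegral_arrivalWeight_le {q a : ℝ} (hq : 0 < q) (ha : 0 < a) (y : 𝒴) :
    ∫⁻ ω, ENNReal.ofReal (arrivalWeight q a y ω) ∂clocks 𝒴 ≤ ENNReal.ofReal (q / a) := by
  have := isProbabilityMeasure_expMeasure (r := 1) one_pos
  refine le_trans (le_of_eq ?_) (lintegral_rpow_weight_le hq ha)
  exact (measurePreserving_eval (fun _ : 𝒴 => expMeasure 1) y).lintegral_comp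
    (f := fun u => ENNReal.ofReal ((1 + u / q) ^ (-(a + 1)))) (by fun_prop)

theorem ae_arrivalWeight_pos {q : ℝ} (hq : 0 < q) (a : ℝ) (y : 𝒴) :
    ∀ᵐ ω ∂clocks 𝒴, 0 < arrivalWeight q a y ω := by
  filter_upwards [ae_clocks_pos] with ω hω
  have := hω y
  unfold arrivalWeight
  positivity

theorem integrable_arrivalWeight {q a : ℝ} (hq : 0 < q) (ha : 0 < a) (y : 𝒴) :
    Integrable (arrivalWeight q a y) (clocks 𝒴) := by
  have hm : Measurable (arrivalWeight q a y) := by unfold arrivalWeight; fun_prop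
  refine ⟨hm.aestronglyMeasurable, ?_⟩
  rw [hasFiniteIntegral_iff_ofReal ((ae_arrivalWeight_pos hq a y).mono fun _ h => h.le)]
  exact (lintegral_arrivalWeight_le hq ha y).trans_lt ENNReal.ofReal_lt_top

theorem integral_arrivalWeight_le {q a : ℝ} (hq : 0 < q) (ha : 0 < a) (y : 𝒴) :
    ∫ ω, arrivalWeight q a y ω ∂clocks 𝒴 ≤ q / a := by
  rw [integral_eq_lintegral_of_nonneg_ae ((ae_arrivalWeight_pos hq a y).mono fun _ h => h.le)
    (integrable_arrivalWeight hq ha y).aestronglyMeasurable]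
  exact ENNReal.toReal_le_of_le_ofReal (by positivity) (lintegral_arrivalWeight_le hq ha y)

end Race

/-! ### Coupling the conditional laws -/

/-- The entropy term of the mass `m`, bounded by coding with the unnormalized weight `φ / c`. -/
theorem negMulLog_le_code {m φ c : ℝ} (hm : 0 ≤ m) (hφ : 0 < φ) (hc : 0 < c) :
    Real.negMulLog m ≤ m * (-Real.log φ + Real.log c - 1) + φ / c := by
  rcases hm.eq_or_lt with rfl | hm
  · simp; positivity
  · have h := Real.log_le_sub_one_of_pos (x := φ / (c * m)) (by positivity)
    rw [Real.log_div hφ.ne' (by positivity), Real.log_mul hc.ne' hm.ne'] at h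
    have h2 := mul_le_mul_of_nonneg_left h hm.le
    have e : m * (φ / (c * m) - 1) = φ / c - m := by field_simp
    rw [Real.negMulLog]
    linarith

/-- The tangent of `log (1 + t)` at `r`, in place of Jensen's inequality. -/
theorem log_one_add_le_tangent {r t : ℝ} (hr : 0 ≤ r) (ht : 0 ≤ t) :
    Real.log (1 + t) ≤ Real.log (1 + r) + (t - r) / (1 + r) := by
  have h := Real.log_le_sub_one_of_pos (x := (1 + t) / (1 + r)) (by positivity)
  rw [Real.log_div (by positivity) (by positivity)] at h
  have e : (1 + t) / (1 + r) - 1 = (t - r) / (1 + r) := by field_simp; ring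
  linarith

variable {𝒳 𝒴 : Type*} [Fintype 𝒳] [Fintype 𝒴]

/-- The mass that `y` receives under the push-forward of `w` along `g`. -/
def pushMass (w : 𝒳 → ℝ) (g : 𝒳 → 𝒴) (y : 𝒴) : ℝ :=
  ∑ x, w x * ({x | g x = y} : Set 𝒳).indicator 1 x

omit [Fintype 𝒴] in
theorem pushMass_nonneg {w : 𝒳 → ℝ} (hw : ∀ x, 0 ≤ w x) (g : 𝒳 → 𝒴) (y : 𝒴) :
    0 ≤ pushMass w g y :=
  Finset.sum_nonneg fun x _ => mul_nonneg (hw x) (indicator_nonneg (fun _ _ => zero_le_one) _)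

omit [Fintype 𝒴] in
/-- If `g` is the function of winners at `ω`, the entropy term of the letter `y` is bounded by an
expression that is affine in `ω y` on each winning event. -/
theorem negMulLog_pushMass_le {w : 𝒳 → ℝ} (hw : ∀ x, 0 ≤ w x) {p : 𝒳 → 𝒴 → ℝ}
    (hp : ∀ x y, 0 ≤ p x y) {ω : 𝒴 → ℝ} {g : 𝒳 → 𝒴} (hg : ∀ x, ω ∈ winSet (p x) (g x))
    (hω : ∀ y, 0 < ω y) {y : 𝒴} {q a : ℝ} (hq : 0 < q) (ha : 0 < a) :
    Real.negMulLog (pushMass w g y) ≤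
      ∑ x, w x * (winSet (p x) y).indicator (fun ω =>
        ((a + 1) * (Real.log (1 + p x y / q) - p x y / q / (1 + p x y / q)) - Real.log a - 1) +
          (a + 1) / (q * (1 + p x y / q)) * ω y) ω + a * arrivalWeight q a y ω := by
  have hy := hω y
  have hφ : 0 < arrivalWeight q a y ω := by unfold arrivalWeight; positivity
  have h := negMulLog_le_code (pushMass_nonneg hw g y) hφ (inv_pos.2 ha)
  rw [div_inv_eq_mul, mul_comm _ a] at h
  refine h.trans ?_
  gcongr
  rw [pushMass, Finset.sum_mul]
  refine Finset.sum_le_sum fun x _ => ?_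
  rw [mul_assoc]
  refine mul_le_mul_of_nonneg_left ?_ (hw x)
  by_cases hx : g x = y
  · rw [indicator_of_mem (by simpa using hx), indicator_of_mem (hx ▸ hg x), Pi.one_apply, one_mul]
    have hr : 0 ≤ p x y / q := div_nonneg (hp x y) hq.le
    have ht := log_one_add_le_tangent hr (div_pos hy hq).le
    rw [arrivalWeight, Real.log_rpow (by positivity), Real.log_inv]
    have h2 := mul_le_mul_of_nonneg_left ht (by positivity : 0 ≤ a + 1)
    have e : (a + 1) * ((ω y / q - p x y / q) / (1 + p x y / q)) =
        (a + 1) / (q * (1 + p x y / q)) * ω y - (a + 1) * (p x y / q / (1 + p x y / q)) := by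
      field_simp
    linarith
  · rw [indicator_of_notMem (by simpa using hx),
      indicator_of_notMem (winSet_disjoint _ hx (hg x)), zero_mul]

omit [Fintype 𝒳] in
/-- The function of winners: `g x` is the winner of the race with rates `p x`. -/
theorem exists_winner (p : 𝒳 → 𝒴 → ℝ) [MeasurableSpace 𝒴] [DiscreteMeasurableSpace 𝒴]
    [Nonempty 𝒴] : ∃ G : (𝒴 → ℝ) → 𝒳 → 𝒴, Measurable G ∧
      ∀ ω x y, ω ∈ winSet (p x) y → G ω x = y := by
  classical
  let G : (𝒴 → ℝ) → 𝒳 → 𝒴 := fun ω x =>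
    if h : ∃ y, ω ∈ winSet (p x) y then h.choose else Classical.arbitrary 𝒴
  have hG : ∀ ω x y, ω ∈ winSet (p x) y → G ω x = y := by
    intro ω x y h
    have h' : ∃ y, ω ∈ winSet (p x) y := ⟨y, h⟩
    by_contra hne
    simp only [G, dif_pos h'] at hne
    exact winSet_disjoint _ hne h'.choose_spec h
  refine ⟨G, measurable_pi_iff.2 fun x => measurable_to_countable' fun y => ?_, hG⟩
  have hset : (fun ω => G ω x) ⁻¹' {y} = winSet (p x) y ∪
      ((⋃ z, winSet (p x) z)ᶜ ∩ {_ω | Classical.arbitrary 𝒴 = y}) := by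
    ext ω
    by_cases h : ∃ z, ω ∈ winSet (p x) z
    · obtain ⟨z, hz⟩ := h
      have h1 : ω ∈ ⋃ z, winSet (p x) z := mem_iUnion.2 ⟨z, hz⟩
      simp only [mem_preimage, mem_singleton_iff, mem_union, mem_inter_iff, mem_compl_iff, h1,
        not_true_eq_false, false_and, or_false, hG ω x z hz]
      refine ⟨fun e => e ▸ hz, fun h2 => ?_⟩
      by_contra hne
      exact winSet_disjoint _ hne hz h2
    · have h1 : ω ∉ ⋃ z, winSet (p x) z := fun h' => h (mem_iUnion.1 h')
      have h2 : ω ∉ winSet (p x) y := fun h' => h ⟨y, h'⟩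
      simp only [mem_preimage, mem_singleton_iff, mem_union, mem_inter_iff, mem_compl_iff, h1,
        not_false_eq_true, true_and, h2, false_or, G, dif_neg h]
      rfl
  rw [hset]
  exact (measurableSet_winSet _ _).union
    ((MeasurableSet.iUnion fun z => measurableSet_winSet _ z).compl.inter (MeasurableSet.const _))

/-- A form of the strong functional representation lemma: some random function `g : 𝒳 → 𝒴` has
`g x` distributed as `p x` for every `x`, and, if `g` is independent of `X` with law `w`, the mean
entropy of `g(X)` given `g` exceeds the mutual information `I` by at most `log (I + 1) + 2`. -/
theorem exists_random_function [DecidableEq 𝒳] {w : 𝒳 → ℝ} (hw : ∀ x, 0 ≤ w x) (hw1 : ∑ x, w x = 1)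
    {p : 𝒳 → 𝒴 → ℝ} (hp : ∀ x y, 0 ≤ p x y) (hp1 : ∀ x, ∑ y, p x y = 1) {q : 𝒴 → ℝ}
    (hq : ∀ y, q y = ∑ x, w x * p x y) {I : ℝ} (hI0 : 0 ≤ I)
    (hI : I = ∑ x, ∑ y, w x * p x y * Real.log (p x y / q y)) :
    ∃ Q : PMF (𝒳 → 𝒴), (∀ x y, (Q.map fun g => g x) y = ENNReal.ofReal (p x y)) ∧
      ∑ g, (Q g).toReal * ∑ y, Real.negMulLog (pushMass w g y) ≤ I + Real.log (I + 1) + 2 := by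
  classical
  let : MeasurableSpace 𝒴 := ⊤
  have hne : Nonempty 𝒴 := by
    by_contra h
    rw [not_nonempty_iff] at h
    have : IsEmpty 𝒳 := ⟨fun x => by simpa using hp1 x⟩
    simp at hw1
  obtain ⟨G, hGm, hG⟩ := exists_winner p
  have hwin : ∀ᵐ ω ∂clocks 𝒴, ∀ x, ω ∈ winSet (p x) (G ω x) := by
    refine ae_all_iff.2 fun x => ?_
    filter_upwards [ae_exists_winSet (hp x) (hp1 x)] with ω ⟨y, hy⟩
    rwa [hG ω x y hy]
  have : IsProbabilityMeasure ((clocks 𝒴).map G) := Measure.isProbabilityMeasure_map hGm.aemeasurable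
  refine ⟨((clocks 𝒴).map G).toPMF, fun x y => ?_, ?_⟩
  · have hm : Measurable fun g : 𝒳 → 𝒴 => g x := measurable_pi_apply x
    rw [← PMF.toMeasure_apply_singleton _ _ (measurableSet_singleton y), ← PMF.toMeasure_map _ _ hm,
      Measure.toPMF_toMeasure, Measure.map_apply hm (measurableSet_singleton y),
      Measure.map_apply hGm (hm (measurableSet_singleton y)), ← clocks_winSet (hp x) (hp1 x)]
    refine measure_congr ?_
    filter_upwards [hwin] with ω hω
    refine propext ⟨fun h => ?_, fun h => hG ω x y h⟩
    have h : G ω x = y := h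
    exact h ▸ hω x
  have hint : ∀ y, Integrable (fun ω => Real.negMulLog (pushMass w (G ω) y)) (clocks 𝒴) := fun y =>
    (integrable_map_measure (f := G) (g := fun g => Real.negMulLog (pushMass w g y))
      (measurable_of_finite _).aestronglyMeasurable hGm.aemeasurable).1 (Integrable.of_finite)
  have hsum : ∑ g, (((clocks 𝒴).map G).toPMF g).toReal *
      ∑ y, Real.negMulLog (pushMass w g y) =
      ∑ y, ∫ ω, Real.negMulLog (pushMass w (G ω) y) ∂clocks 𝒴 := by
    rw [← integral_finsetSum _ fun y _ => hint y]
    rw [← integral_map (φ := G) (f := fun g => ∑ y, Real.negMulLog (pushMass w g y))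
      hGm.aemeasurable (measurable_of_finite _).aestronglyMeasurable,
      integral_fintype Integrable.of_finite]
    rfl
  have hq0 : ∀ y, 0 ≤ q y := fun y => by
    rw [hq]; exact Finset.sum_nonneg fun x _ => mul_nonneg (hw x) (hp x y)
  -- This exponent minimizes `(a + 1) (I + 1) - log a`, the bound that the code gives.
  set a : ℝ := 1 / (I + 1) with ha_def
  have ha : 0 < a := by positivity
  have hy : ∀ y, ∫ ω, Real.negMulLog (pushMass w (G ω) y) ∂clocks 𝒴 ≤
      (a + 1) * ∑ x, w x * p x y * Real.log (1 + p x y / q y) - q y * Real.log a := by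
    intro y
    rcases (hq0 y).eq_or_lt with h0 | h0
    -- A letter of probability zero almost surely receives no mass; its arrival time `ω y / 0` would
    -- be a junk value.
    · have hz : ∀ x, w x * p x y = 0 := fun x => by
        have := (Finset.sum_eq_zero_iff_of_nonneg fun x _ => mul_nonneg (hw x) (hp x y)).1
          ((hq y).symm.trans h0.symm)
        exact this x (Finset.mem_univ x)
      have : ∀ᵐ ω ∂clocks 𝒴, Real.negMulLog (pushMass w (G ω) y) = 0 := by
        filter_upwards [hwin] with ω hω
        have : pushMass w (G ω) y = 0 := by
          refine Finset.sum_eq_zero fun x _ => ?_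
          by_cases h : G ω x = y
          · have h1 := (hω x).1
            rw [h] at h1
            rw [(mul_eq_zero.1 (hz x)).resolve_right h1.ne', zero_mul]
          · rw [indicator_of_notMem (by simpa using h), mul_zero]
        rw [this, Real.negMulLog_zero]
      rw [integral_congr_ae this]
      simp [hz, ← h0]
    · let α : 𝒳 → ℝ := fun x => (a + 1) * (Real.log (1 + p x y / q y) -
        p x y / q y / (1 + p x y / q y)) - Real.log a - 1
      let β : 𝒳 → ℝ := fun x => (a + 1) / (q y * (1 + p x y / q y))
      have hi := fun x => (integrable_winSet_affine (hp x) (hp1 x) y (α x) (β x)).const_mul (w x)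
      have hle : ∀ᵐ ω ∂clocks 𝒴, Real.negMulLog (pushMass w (G ω) y) ≤
          ∑ x, w x * (winSet (p x) y).indicator (fun ω => α x + β x * ω y) ω +
            a * arrivalWeight (q y) a y ω := by
        filter_upwards [hwin, ae_clocks_pos] with ω h1 h2
        exact negMulLog_pushMass_le hw hp h1 h2 h0 ha
      refine (integral_mono_ae (hint y) ((integrable_finsetSum _ fun x _ => hi x).add
        ((integrable_arrivalWeight h0 ha y).const_mul a)) hle).trans ?_
      · simp only [Pi.add_apply]
        rw [integral_add (integrable_finsetSum _ fun x _ => hi x)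
          ((integrable_arrivalWeight h0 ha y).const_mul a),
          integral_finsetSum _ fun x _ => hi x, integral_const_mul]
        simp_rw [integral_const_mul, integral_winSet_affine (hp _) (hp1 _)]
        have h3 := mul_le_mul_of_nonneg_left (integral_arrivalWeight_le h0 ha y) ha.le
        rw [mul_div_cancel₀ _ ha.ne'] at h3
        have h4 : ∀ x, w x * (α x * p x y + β x * (p x y * p x y)) =
            (a + 1) * (w x * p x y * Real.log (1 + p x y / q y)) -
              (w x * p x y) * (Real.log a + 1) := by
          intro x
          have : 0 < 1 + p x y / q y := by have := hp x y; positivity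
          simp only [α, β]
          field_simp
          ring
        rw [Finset.sum_congr rfl fun x _ => h4 x, Finset.sum_sub_distrib, ← Finset.mul_sum,
          ← Finset.sum_mul, ← hq]
        linarith
  rw [hsum]
  refine (Finset.sum_le_sum fun y _ => hy y).trans ?_
  rw [Finset.sum_sub_distrib, ← Finset.mul_sum, ← Finset.sum_mul]
  have hq1 : ∑ y, q y = 1 := by
    simp_rw [hq]
    rw [Finset.sum_comm]
    simp_rw [← Finset.mul_sum, hp1, mul_one, hw1]
  have hle : ∑ y, ∑ x, w x * p x y * Real.log (1 + p x y / q y) ≤ I + 1 := by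
    have h1 : ∀ x y, w x * p x y * Real.log (1 + p x y / q y) ≤
        w x * p x y * Real.log (p x y / q y) + w x * q y := by
      intro x y
      rcases (hp x y).eq_or_lt with h | h
      · simp [← h, mul_nonneg (hw x) (hq0 y)]
      rcases (hw x).eq_or_lt with h' | h'
      · simp [← h']
      have hqy : 0 < q y := by
        rw [hq]
        exact Finset.sum_pos' (fun x _ => mul_nonneg (hw x) (hp x y))
          ⟨x, Finset.mem_univ x, mul_pos h' h⟩
      have h2 : Real.log (1 + p x y / q y) ≤ Real.log (p x y / q y) + q y / p x y := by
        have := Real.log_le_sub_one_of_pos (x := (1 + p x y / q y) / (p x y / q y))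
          (by positivity)
        rw [Real.log_div (by positivity) (by positivity)] at this
        have e : (1 + p x y / q y) / (p x y / q y) - 1 = q y / p x y := by
          field_simp; ring
        linarith
      calc _ ≤ w x * p x y * (Real.log (p x y / q y) + q y / p x y) := by gcongr
        _ = _ := by field_simp
    rw [Finset.sum_comm, hI]
    calc _ ≤ ∑ x, ∑ y, (w x * p x y * Real.log (p x y / q y) + w x * q y) :=
          Finset.sum_le_sum fun x _ => Finset.sum_le_sum fun y _ => h1 x y
      _ = _ := by
        simp_rw [Finset.sum_add_distrib, ← Finset.mul_sum, hq1, mul_one, hw1]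
  have h5 := mul_le_mul_of_nonneg_left hle (by positivity : 0 ≤ a + 1)
  have h6 : (a + 1) * (I + 1) = I + 2 := by rw [ha_def]; field_simp; ring
  have h7 : Real.log a = -Real.log (I + 1) := by rw [ha_def, one_div, Real.log_inv]
  rw [hq1, h7]
  linarith

/-! ### Entropy and mutual information -/

section Information

variable {Ω Ω' α β γ : Type*}

theorem hasSum_toReal (p : PMF α) : HasSum (fun a => (p a).toReal) 1 := by
  have h := ENNReal.hasSum_toReal (f := p) (by rw [PMF.tsum_coe]; exact ENNReal.one_ne_top)
  rwa [← ENNReal.tsum_toReal_eq fun a => PMF.apply_ne_top _ _, PMF.tsum_coe,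
    ENNReal.toReal_one] at h

theorem sum_toReal [Fintype α] (p : PMF α) : ∑ a, (p a).toReal = 1 := by
  rw [← tsum_fintype (L := .unconditional _)]
  exact (hasSum_toReal p).tsum_eq

theorem tsum_pair_right (p : PMF Ω) (A : Ω → α) (B : Ω → β) (a : α) :
    ∑' b, (p.map fun ω => (A ω, B ω)) (a, b) = (p.map A) a := by
  classical
  have h : p.map A = (p.map fun ω => (A ω, B ω)).map Prod.fst := by rw [PMF.map_comp]; rfl
  rw [h, PMF.map_apply, ENNReal.tsum_prod', tsum_eq_single a]
  · simp
  · intro a' ha'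
    simp [Ne.symm ha']

theorem map_swap_apply (p : PMF Ω) (A : Ω → α) (B : Ω → β) (a : α) (b : β) :
    (p.map fun ω => (B ω, A ω)) (b, a) = (p.map fun ω => (A ω, B ω)) (a, b) := by
  classical
  simp only [PMF.map_apply, Prod.mk.injEq, and_comm]

theorem hasSum_pair_right (p : PMF Ω) (A : Ω → α) (B : Ω → β) (a : α) :
    HasSum (fun b => ((p.map fun ω => (A ω, B ω)) (a, b)).toReal) ((p.map A) a).toReal := by
  rw [← tsum_pair_right p A B, ENNReal.tsum_toReal_eq fun b => PMF.apply_ne_top _ _]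
  exact ENNReal.hasSum_toReal (by rw [tsum_pair_right]; exact PMF.apply_ne_top _ _)

theorem sum_pair_right [Fintype β] (p : PMF Ω) (A : Ω → α) (B : Ω → β) (a : α) :
    ∑ b, ((p.map fun ω => (A ω, B ω)) (a, b)).toReal = ((p.map A) a).toReal := by
  rw [← tsum_fintype (L := .unconditional _)]
  exact (hasSum_pair_right p A B a).tsum_eq

theorem sum_pair_left [Fintype α] (p : PMF Ω) (A : Ω → α) (B : Ω → β) (b : β) :
    ∑ a, ((p.map fun ω => (A ω, B ω)) (a, b)).toReal = ((p.map B) b).toReal := by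
  rw [← sum_pair_right p B A]
  exact Finset.sum_congr rfl fun a _ => by rw [map_swap_apply]

/-- A mutual information between two discrete variables, the first with finite alphabet, is
nonnegative. -/
theorem mutualInfo_nonneg [Finite α] (p : PMF Ω) (A : Ω → α) (B : Ω → β) :
    0 ≤ mutualInfo p A B := by
  have := Fintype.ofFinite α
  have hprod := (hasSum_toReal (p.map A)).mul (hasSum_toReal (p.map B))
    ((hasSum_toReal (p.map A)).summable.mul_of_nonneg (hasSum_toReal (p.map B)).summable
      (fun _ => ENNReal.toReal_nonneg) (fun _ => ENNReal.toReal_nonneg))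
  have hsub := (hasSum_toReal (p.map fun ω => (A ω, B ω))).sub hprod
  have h := hasSum_le (fun c => ?_) hsub (summable_mutualInfo p A B).hasSum
  · rwa [one_mul, sub_self] at h
  have h1 := map_pair_le_fst p A B c
  have h2 := map_pair_le_snd p A B c
  have h0 : 0 ≤ ((p.map fun ω => (A ω, B ω)) c).toReal := ENNReal.toReal_nonneg
  generalize ((p.map fun ω => (A ω, B ω)) c).toReal = r at h0 h1 h2 ⊢
  generalize ((p.map A) c.1).toReal = s at h1 ⊢
  generalize ((p.map B) c.2).toReal = t at h2 ⊢
  rcases h0.eq_or_lt with rfl | hr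
  · simpa using mul_nonneg h1 h2
  have hs : 0 < s := hr.trans_le h1
  have ht : 0 < t := hr.trans_le h2
  have h3 := Real.one_sub_inv_le_log_of_pos (x := r / (s * t)) (by positivity)
  have h4 := mul_le_mul_of_nonneg_left h3 hr.le
  have e : r * (1 - (r / (s * t))⁻¹) = r - s * t := by field_simp
  linarith

theorem mutualInfo_map (p : PMF Ω) (f : Ω → Ω') (A : Ω' → α) (B : Ω' → β) :
    mutualInfo (p.map f) A B = mutualInfo p (fun ω => A (f ω)) (fun ω => B (f ω)) := by
  simp only [mutualInfo, PMF.map_comp]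
  rfl

theorem map_equiv_apply (p : PMF Ω) (A : Ω → α) (e : α ≃ β) (a : α) :
    (p.map fun ω => e (A ω)) (e a) = (p.map A) a := by
  classical
  simp only [PMF.map_apply, e.injective.eq_iff]

/-- Relabelling the second variable does not change the mutual information. -/
theorem mutualInfo_equiv_right (p : PMF Ω) (A : Ω → α) (B : Ω → β) (e : β ≃ γ) :
    mutualInfo p A (fun ω => e (B ω)) = mutualInfo p A B := by
  unfold mutualInfo
  rw [← (Equiv.prodCongr (Equiv.refl α) e).tsum_eq]
  refine tsum_congr fun c => ?_
  have h := map_equiv_apply p (fun ω => (A ω, B ω)) (Equiv.prodCongr (Equiv.refl α) e) c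
  simp only [Equiv.prodCongr_apply, Equiv.coe_refl, Prod.map, id] at h ⊢
  rw [h, map_equiv_apply]

/-- The Shannon entropy, in nats, of a random variable with finite alphabet. -/
def entropy [Fintype α] (p : PMF Ω) (A : Ω → α) : ℝ := ∑ a, Real.negMulLog ((p.map A) a).toReal

theorem mutualInfo_le_entropy [Fintype α] (p : PMF Ω) (A : Ω → α) (B : Ω → β) :
    mutualInfo p A B ≤ entropy p A := by
  have hs : HasSum (fun c : α × β => ((p.map fun ω => (A ω, B ω)) c).toReal *
      -Real.log ((p.map A) c.1).toReal) (entropy p A) := by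
    have hsum : Summable fun c : α × β => ((p.map fun ω => (A ω, B ω)) c).toReal *
        -Real.log ((p.map A) c.1).toReal := by
      refine ((hasSum_toReal (p.map fun ω => (A ω, B ω))).summable.mul_right
        (∑ a, |Real.log ((p.map A) a).toReal|)).of_norm_bounded fun c => ?_
      rw [norm_mul, Real.norm_of_nonneg ENNReal.toReal_nonneg, norm_neg, Real.norm_eq_abs]
      exact mul_le_mul_of_nonneg_left (Finset.single_le_sum
        (f := fun a => |Real.log ((p.map A) a).toReal|) (fun a _ => abs_nonneg _)
        (Finset.mem_univ c.1)) ENNReal.toReal_nonneg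
    have h := hsum.hasSum.prod_fiberwise fun a => (hasSum_pair_right p A B a).mul_right
      (-Real.log ((p.map A) a).toReal)
    have e : entropy p A = ∑' c : α × β, ((p.map fun ω => (A ω, B ω)) c).toReal *
        -Real.log ((p.map A) c.1).toReal := by
      rw [← h.tsum_eq, tsum_fintype, entropy]
      refine Finset.sum_congr rfl fun a _ => ?_
      rw [Real.negMulLog, neg_mul, mul_neg]
    rw [e]
    exact hsum.hasSum
  refine hasSum_le (fun c => ?_) (summable_mutualInfo p A B).hasSum hs
  have h1 := map_pair_le_fst p A B c
  have h2 := map_pair_le_snd p A B c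
  have h0 : 0 ≤ ((p.map fun ω => (A ω, B ω)) c).toReal := ENNReal.toReal_nonneg
  generalize ((p.map fun ω => (A ω, B ω)) c).toReal = r at h0 h1 h2 ⊢
  generalize ((p.map A) c.1).toReal = s at h1 ⊢
  generalize ((p.map B) c.2).toReal = t at h2 ⊢
  rcases h0.eq_or_lt with rfl | hr
  · simp
  have hs : 0 < s := hr.trans_le h1
  have ht : 0 < t := hr.trans_le h2
  refine mul_le_mul_of_nonneg_left ?_ hr.le
  rw [Real.log_div hr.ne' (by positivity), Real.log_mul hs.ne' ht.ne']
  have := Real.log_le_log hr h2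
  linarith

theorem sum_map_mul [Fintype α] [Fintype β] (p : PMF Ω) (A : Ω → α) (g : α → β) (f : β → ℝ) :
    ∑ a, ((p.map A) a).toReal * f (g a) = ∑ b, ((p.map fun ω => g (A ω)) b).toReal * f b := by
  have h (a : α) (b : β) : ((p.map fun ω => (A ω, g (A ω))) (a, b)).toReal * f (g a) =
      ((p.map fun ω => (A ω, g (A ω))) (a, b)).toReal * f b := by
    classical
    by_cases hb : g a = b
    · rw [hb]
    · have : (p.map fun ω => (A ω, g (A ω))) (a, b) = 0 := by
        rw [PMF.map_apply, ENNReal.tsum_eq_zero]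
        intro ω
        rw [if_neg]
        rintro h
        rw [Prod.mk.injEq] at h
        exact hb (by rw [h.1, h.2])
      simp [this]
  calc _ = ∑ a, ∑ b, ((p.map fun ω => (A ω, g (A ω))) (a, b)).toReal * f (g a) := by
        simp_rw [← Finset.sum_mul, sum_pair_right]
    _ = ∑ a, ∑ b, ((p.map fun ω => (A ω, g (A ω))) (a, b)).toReal * f b := by simp_rw [h]
    _ = _ := by rw [Finset.sum_comm]; simp_rw [← Finset.sum_mul, sum_pair_left]

theorem map_comp_le (p : PMF Ω) (A : Ω → α) (g : α → β) (a : α) :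
    ((p.map A) a).toReal ≤ ((p.map fun ω => g (A ω)) (g a)).toReal := by
  classical
  refine ENNReal.toReal_mono (PMF.apply_ne_top _ _) ?_
  rw [PMF.map_apply, PMF.map_apply]
  refine ENNReal.tsum_le_tsum fun ω => ?_
  by_cases h : a = A ω
  · simp [h]
  · simp [h]

/-- Entropy is subadditive, by Gibbs' inequality against the product of the marginals. -/
theorem entropy_pi_le {ι : Type*} [Fintype ι] [DecidableEq ι] {β : ι → Type*} [∀ i, Fintype (β i)]
    (p : PMF Ω) (B : ∀ i, Ω → β i) :
    entropy p (fun ω i => B i ω) ≤ ∑ i, entropy p (B i) := by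
  set r : (∀ i, β i) → ℝ := fun v => ((p.map fun ω i => B i ω) v).toReal with hr
  set q : ∀ i, β i → ℝ := fun i b => ((p.map (B i)) b).toReal with hq
  have hq0 : ∀ i b, 0 ≤ q i b := fun i b => ENNReal.toReal_nonneg
  have hr0 : ∀ v, 0 ≤ r v := fun v => ENNReal.toReal_nonneg
  have hle : ∀ v i, r v ≤ q i (v i) := fun v i =>
    map_comp_le p (fun ω i => B i ω) (fun v : ∀ i, β i => v i) v
  have hpt : ∀ v, Real.negMulLog (r v) ≤
      ∑ i, r v * -Real.log (q i (v i)) + (∏ i, q i (v i) - r v) := by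
    intro v
    rcases (hr0 v).eq_or_lt with h | h
    · rw [← h]
      simpa using Finset.prod_nonneg fun i _ => hq0 i (v i)
    · have hpos : ∀ i, 0 < q i (v i) := fun i => h.trans_le (hle v i)
      have h1 := negMulLog_le_code (hr0 v) (Finset.prod_pos fun i (_ : i ∈ Finset.univ) => hpos i) one_pos
      rw [Real.log_prod fun i _ => (hpos i).ne', Real.log_one, div_one] at h1
      rw [← Finset.mul_sum, Finset.sum_neg_distrib]
      linarith
  calc entropy p (fun ω i => B i ω) ≤
        ∑ v, (∑ i, r v * -Real.log (q i (v i)) + (∏ i, q i (v i) - r v)) :=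
        Finset.sum_le_sum fun v _ => hpt v
    _ = ∑ i, ∑ v, r v * -Real.log (q i (v i)) := by
      have h1 : ∑ v : ∀ i, β i, ∏ i, q i (v i) = 1 := by
        rw [← Fintype.piFinset_univ, ← Finset.prod_univ_sum]
        exact Finset.prod_eq_one fun i _ => sum_toReal _
      have h2 : ∑ v, r v = 1 := sum_toReal _
      rw [Finset.sum_add_distrib, Finset.sum_sub_distrib, h1, h2, sub_self, add_zero,
        Finset.sum_comm]
    _ = _ := by
      refine Finset.sum_congr rfl fun i _ => ?_
      rw [hr, sum_map_mul p (fun ω i => B i ω) (fun v : ∀ i, β i => v i)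
        (fun b => -Real.log (q i b)), entropy]
      simp [Real.negMulLog, hq]

/-- `I(A;B) + H(A|B) = H(A)`. -/
theorem mutualInfo_add_condEntropy [Fintype α] [Fintype β] (p : PMF Ω) (A : Ω → α) (B : Ω → β) :
    mutualInfo p A B + condEntropy p A B = entropy p A := by
  rw [mutualInfo, tsum_fintype, Fintype.sum_prod_type, condEntropy, ← Finset.sum_add_distrib]
  refine Finset.sum_congr rfl fun a _ => ?_
  rw [← Finset.sum_add_distrib, Real.negMulLog, neg_mul, ← mul_neg, ← sum_pair_right p A B a,
    Finset.sum_mul]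
  refine Finset.sum_congr rfl fun b _ => ?_
  rw [sum_pair_right p A B a]
  have h1 := map_pair_le_fst p A B (a, b)
  have h2 := map_pair_le_snd p A B (a, b)
  have h0 : 0 ≤ ((p.map fun ω => (A ω, B ω)) (a, b)).toReal := ENNReal.toReal_nonneg
  dsimp only at h1 h2 ⊢
  rcases h0.eq_or_lt with h | hr
  · rw [← h]; simp
  have hs := hr.trans_le h1
  have ht := hr.trans_le h2
  rw [Real.log_div hr.ne' (by positivity), Real.log_mul hs.ne' ht.ne',
    Real.log_div ht.ne' hr.ne']
  ring

end Information

/-- A function of a finite random variable has at most its entropy. -/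
theorem sum_negMulLog_pushMass_le {𝒳 𝒴 : Type*} [Fintype 𝒳] [Fintype 𝒴] {w : 𝒳 → ℝ}
    (hw : ∀ x, 0 ≤ w x) (g : 𝒳 → 𝒴) :
    ∑ y, Real.negMulLog (pushMass w g y) ≤ ∑ x, Real.negMulLog (w x) := by
  classical
  have h : ∀ y, Real.negMulLog (pushMass w g y) =
      ∑ x, w x * ({x | g x = y} : Set 𝒳).indicator 1 x * -Real.log (pushMass w g y) := by
    intro y
    rw [← Finset.sum_mul, Real.negMulLog, neg_mul, mul_neg]
    rfl
  simp_rw [h]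
  rw [Finset.sum_comm]
  refine Finset.sum_le_sum fun x _ => ?_
  rw [Finset.sum_eq_single (g x)]
  · rw [indicator_of_mem (by simp), Pi.one_apply, mul_one, Real.negMulLog, neg_mul, mul_neg,
      neg_le_neg_iff]
    rcases (hw x).eq_or_lt with h0 | h0
    · simp [← h0]
    · refine mul_le_mul_of_nonneg_left (Real.log_le_log h0 ?_) h0.le
      have := Finset.single_le_sum (f := fun x' => w x' * ({x' | g x' = g x} : Set 𝒳).indicator 1 x')
        (fun x' _ => mul_nonneg (hw x') (indicator_nonneg (fun _ _ => zero_le_one) _))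
        (Finset.mem_univ x)
      simpa [pushMass] using this
  · intro y _ hy
    rw [indicator_of_notMem (by simpa using hy.symm)]
    simp
  · simp

/-! ### Mechanisms without leakage -/

section RandomFunction

variable {𝒳 𝒴 : Type*}

/-- The joint law of `((X, g X), g)`, where `X` has law `w` and `g` is an independent random
function with law `Q`. -/
def functionLaw (w : PMF 𝒳) (Q : PMF (𝒳 → 𝒴)) : PMF ((𝒳 × 𝒴) × (𝒳 → 𝒴)) :=
  w.bind fun x => Q.map fun g => ((x, g x), g)

theorem functionLaw_apply [DecidableEq 𝒴] (w : PMF 𝒳) (Q : PMF (𝒳 → 𝒴)) (x : 𝒳) (y : 𝒴)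
    (g : 𝒳 → 𝒴) : functionLaw w Q ((x, y), g) = w x * if g x = y then Q g else 0 := by
  classical
  rw [functionLaw, PMF.bind_apply, tsum_eq_single x]
  · rw [PMF.map_apply, tsum_eq_single g]
    · simp [eq_comm]
    · intro g' hg'
      rw [if_neg]
      rintro h
      exact hg' (congrArg Prod.snd h).symm
  · intro x' hx'
    rw [PMF.map_apply, ENNReal.tsum_eq_zero.2, mul_zero]
    intro g'
    rw [if_neg]
    rintro h
    exact hx' (congrArg (fun v => v.1.1) h).symm

theorem functionLaw_map_fst (w : PMF 𝒳) (Q : PMF (𝒳 → 𝒴)) :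
    (functionLaw w Q).map (fun ω => ω.1.1) = w := by
  rw [functionLaw, PMF.map_bind]
  simp only [PMF.map_comp]
  exact (congrArg w.bind (funext fun x => PMF.map_const Q x)).trans (PMF.bind_pure w)

theorem functionLaw_map_snd (w : PMF 𝒳) (Q : PMF (𝒳 → 𝒴)) :
    (functionLaw w Q).map (fun ω => ω.2) = Q := by
  rw [functionLaw, PMF.map_bind]
  simp only [PMF.map_comp]
  exact (congrArg w.bind (funext fun x => PMF.map_id Q)).trans (PMF.bind_const w Q)

theorem functionLaw_map_fst_snd (w : PMF 𝒳) (Q : PMF (𝒳 → 𝒴)) (x : 𝒳) (g : 𝒳 → 𝒴) :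
    (functionLaw w Q).map (fun ω => (ω.1.1, ω.2)) (x, g) = w x * Q g := by
  classical
  have h : (functionLaw w Q).map (fun ω => (ω.1.1, ω.2)) =
      w.bind fun x => Q.map fun g => (x, g) := by
    rw [functionLaw, PMF.map_bind]
    simp only [PMF.map_comp]
    rfl
  rw [h, PMF.bind_apply, tsum_eq_single x]
  · rw [PMF.map_apply, tsum_eq_single g]
    · simp
    · intro g' hg'
      rw [if_neg]
      rintro h
      exact hg' (congrArg Prod.snd h).symm
  · intro x' hx'
    rw [PMF.map_apply, ENNReal.tsum_eq_zero.2, mul_zero]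
    intro g'
    rw [if_neg]
    rintro h
    exact hx' (congrArg Prod.fst h).symm

/-- Given `g`, the law of `Y = g(X)` is the push-forward of the law of `X`. -/
theorem functionLaw_map_snd_snd [Fintype 𝒳] (w : PMF 𝒳) (Q : PMF (𝒳 → 𝒴)) (y : 𝒴)
    (g : 𝒳 → 𝒴) : ((functionLaw w Q).map (fun ω => (ω.1.2, ω.2)) (y, g)).toReal =
      (Q g).toReal * pushMass (fun x => (w x).toReal) g y := by
  classical
  have h : (functionLaw w Q).map (fun ω => (ω.1.2, ω.2)) =
      w.bind fun x => Q.map fun g => (g x, g) := by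
    rw [functionLaw, PMF.map_bind]
    simp only [PMF.map_comp]
    rfl
  rw [h, PMF.bind_apply, tsum_fintype, ENNReal.toReal_sum
    fun x _ => ENNReal.mul_ne_top (PMF.apply_ne_top _ _) (PMF.apply_ne_top _ _), pushMass,
    Finset.mul_sum]
  refine Finset.sum_congr rfl fun x _ => ?_
  rw [ENNReal.toReal_mul, PMF.map_apply, tsum_eq_single g]
  · by_cases hx : g x = y
    · rw [if_pos (by rw [hx]), indicator_of_mem (by simpa using hx), Pi.one_apply]
      ring
    · rw [if_neg (fun h' => hx (congrArg Prod.fst h').symm),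
        indicator_of_notMem (by simpa using hx)]
      simp
  · intro g' hg'
    rw [if_neg]
    rintro h
    exact hg' (congrArg Prod.snd h).symm

/-- A random function that is independent of `X` reveals nothing about `X`. -/
theorem mutualInfo_functionLaw_fst (w : PMF 𝒳) (Q : PMF (𝒳 → 𝒴)) :
    mutualInfo (functionLaw w Q) (fun ω => ω.1.1) (fun ω => ω.2) = 0 := by
  rw [mutualInfo]
  refine (tsum_congr fun c => ?_).trans tsum_zero
  rw [functionLaw_map_fst_snd, functionLaw_map_fst, functionLaw_map_snd, ENNReal.toReal_mul]
  rcases eq_or_ne ((w c.1).toReal * (Q c.2).toReal) 0 with h | h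
  · rw [h, zero_mul]
  · rw [div_self h, Real.log_one, mul_zero]

/-- `I(Y;g) = H(Y) - H(g(X)|g)` for `Y = g(X)`. -/
theorem mutualInfo_functionLaw_snd [Fintype 𝒳] [Fintype 𝒴] [DecidableEq 𝒳] (w : PMF 𝒳)
    (Q : PMF (𝒳 → 𝒴)) :
    mutualInfo (functionLaw w Q) (fun ω => ω.1.2) (fun ω => ω.2) =
      entropy (functionLaw w Q) (fun ω => ω.1.2) -
        ∑ g, (Q g).toReal * ∑ y, Real.negMulLog (pushMass (fun x => (w x).toReal) g y) := by
  set T := functionLaw w Q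
  have hm (y : 𝒴) (g : 𝒳 → 𝒴) : 0 ≤ pushMass (fun x => (w x).toReal) g y :=
    pushMass_nonneg (fun x => ENNReal.toReal_nonneg) g y
  have h1 (y : 𝒴) (g : 𝒳 → 𝒴) : ((T.map fun ω => (ω.1.2, ω.2)) (y, g)).toReal *
      Real.log (((T.map fun ω => (ω.1.2, ω.2)) (y, g)).toReal /
        (((T.map fun ω => ω.1.2) y).toReal * ((T.map fun ω => ω.2) g).toReal)) =
      ((T.map fun ω => (ω.1.2, ω.2)) (y, g)).toReal *
        -Real.log ((T.map fun ω => ω.1.2) y).toReal -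
      (Q g).toReal * Real.negMulLog (pushMass (fun x => (w x).toReal) g y) := by
    have hle := map_pair_le_fst T (fun ω => ω.1.2) (fun ω => ω.2) (y, g)
    have hTs : T.map (fun ω => ω.2) = Q := functionLaw_map_snd w Q
    have hTp : ((T.map fun ω => (ω.1.2, ω.2)) (y, g)).toReal = _ :=
      functionLaw_map_snd_snd w Q y g
    rw [hTs]
    rw [hTp] at hle ⊢
    have hq0 : 0 ≤ (Q g).toReal := ENNReal.toReal_nonneg
    have hm0 := hm y g
    dsimp only at hle
    generalize ((T.map fun ω => ω.1.2) y).toReal = t at hle ⊢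
    generalize (Q g).toReal = u at hq0 hle ⊢
    generalize pushMass (fun x => (w x).toReal) g y = m at hm0 hle ⊢
    rcases hq0.eq_or_lt with rfl | hu
    · simp
    rcases hm0.eq_or_lt with rfl | hm0
    · simp
    have ht : 0 < t := (mul_pos hu hm0).trans_le hle
    rw [mul_comm t u, mul_div_mul_left _ _ hu.ne', Real.log_div hm0.ne' ht.ne', Real.negMulLog]
    ring
  rw [mutualInfo, tsum_fintype, Fintype.sum_prod_type]
  simp_rw [h1, Finset.sum_sub_distrib, ← Finset.sum_mul,
    sum_pair_right T (fun ω => ω.1.2) (fun ω => ω.2)]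
  congr 1
  · exact Finset.sum_congr rfl fun y _ => by rw [Real.negMulLog, neg_mul, mul_neg]
  · rw [Finset.sum_comm]
    simp_rw [Finset.mul_sum]

/-- If the random function has the conditional laws `P_{Y|X}`, then `(X, g X)` has law `P`, and
disclosing `g` is a mechanism: `P_{U|X,Y}` is the law of `g` conditioned on `g x = y`. The
alphabet is relabelled as an initial segment of the naturals. -/
theorem exists_mechanism_of_functionLaw [Finite 𝒳] [Finite 𝒴] (P : PMF (𝒳 × 𝒴))
    (Q : PMF (𝒳 → 𝒴))
    (hQ : ∀ x y, (P.map Prod.fst) x * (Q.map fun g => g x) y = P (x, y)) :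
    ∃ (W : Mechanism 𝒳 𝒴) (e : (𝒳 → 𝒴) ≃ W.Out),
      W.joint P = (functionLaw (P.map Prod.fst) Q).map fun ω => (ω.1, e ω.2) := by
  classical
  obtain ⟨n, ⟨e⟩⟩ := Finite.exists_equiv_fin (𝒳 → 𝒴)
  -- Pairs `(x, y)` that no function in the support of `Q` hits have probability zero.
  let F : 𝒳 × 𝒴 → PMF (𝒳 → 𝒴) := fun xy =>
    if h : ∃ g ∈ {g : 𝒳 → 𝒴 | g xy.1 = xy.2}, g ∈ Q.support then Q.filter _ h else Q
  refine ⟨⟨Fin n, inferInstance, fun xy => (F xy).map e⟩, e, ?_⟩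
  have hT : (P.bind fun xy => (F xy).map fun g => (xy, g)) = functionLaw (P.map Prod.fst) Q := by
    ext ⟨⟨x, y⟩, g⟩
    rw [functionLaw_apply, PMF.bind_apply, tsum_eq_single (x, y)]
    swap
    · intro v hv
      rw [PMF.map_apply, ENNReal.tsum_eq_zero.2, mul_zero]
      intro g'
      rw [if_neg]
      rintro h
      exact hv (congrArg Prod.fst h).symm
    rw [PMF.map_apply, tsum_eq_single g]
    swap
    · intro g' hg'
      rw [if_neg]
      rintro h
      exact hg' (congrArg Prod.snd h).symm
    rw [if_pos rfl, ← hQ x y]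
    have hind : ∑' g, ({g : 𝒳 → 𝒴 | g x = y} : Set _).indicator Q g = (Q.map fun g => g x) y := by
      rw [PMF.map_apply]
      refine tsum_congr fun g => ?_
      by_cases h : g x = y
      · rw [indicator_of_mem (by simpa using h), if_pos h.symm]
      · rw [indicator_of_notMem (by simpa using h), if_neg (Ne.symm h)]
    by_cases h0 : (Q.map fun g => g x) y = 0
    · have : (if g x = y then Q g else 0) = 0 := by
        rw [← hind, ENNReal.tsum_eq_zero] at h0
        by_cases h : g x = y
        · rw [if_pos h]
          simpa [h] using h0 g
        · rw [if_neg h]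
      rw [this, h0, mul_zero, zero_mul]
    · have h : ∃ g ∈ {g : 𝒳 → 𝒴 | g x = y}, g ∈ Q.support := by
        by_contra hne
        push Not at hne
        refine h0 ?_
        rw [← hind, ENNReal.tsum_eq_zero]
        intro g
        by_cases hg : g ∈ {g : 𝒳 → 𝒴 | g x = y}
        · rw [indicator_of_mem hg]
          simpa using hne g hg
        · rw [indicator_of_notMem hg]
      have hF : F (x, y) = Q.filter {g | g x = y} h := dif_pos h
      rw [hF, PMF.filter_apply, hind, mul_assoc, mul_comm (_ : ℝ≥0∞) (_⁻¹), ← mul_assoc _ (_⁻¹),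
        ENNReal.mul_inv_cancel h0 (PMF.apply_ne_top _ _), one_mul]
      congr 1
  rw [← hT, PMF.map_bind]
  simp only [Mechanism.joint, PMF.map_comp]
  rfl

end RandomFunction

theorem joint_map_fst {𝒳 𝒴 : Type*} (W : Mechanism 𝒳 𝒴) (P : PMF (𝒳 × 𝒴)) :
    (W.joint P).map Prod.fst = P := by
  rw [Mechanism.joint, PMF.map_bind]
  simp only [PMF.map_comp]
  exact (congrArg P.bind (funext fun x => PMF.map_const _ x)).trans (PMF.bind_pure P)

theorem joint_map_comp_fst {𝒳 𝒴 γ : Type*} (W : Mechanism 𝒳 𝒴) (P : PMF (𝒳 × 𝒴))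
    (f : 𝒳 × 𝒴 → γ) : (W.joint P).map (fun ω => f ω.1) = P.map f := by
  conv_rhs => rw [← joint_map_fst W P, PMF.map_comp]
  rfl

/-- The information disclosed about `f(Y)` is at most `H(f(Y))`. -/
theorem infoAbout_le_entropy {𝒳 𝒴 γ : Type*} [Fintype γ] (W : Mechanism 𝒳 𝒴) (P : PMF (𝒳 × 𝒴))
    (f : 𝒴 → γ) : W.infoAbout P f ≤ entropy P (fun xy => f xy.2) := by
  refine (mutualInfo_le_entropy _ _ _).trans_eq ?_
  rw [entropy, entropy, joint_map_comp_fst W P fun xy => f xy.2]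

/-- There is a mechanism without leakage whose utility falls short of `H(Y)` by at most each of
the two constants. -/
theorem exists_mechanism_leakage_eq_zero {𝒳 𝒴 : Type*} [Fintype 𝒳] [Fintype 𝒴]
    (P : PMF (𝒳 × 𝒴)) : ∃ W : Mechanism 𝒳 𝒴, W.leakage P = 0 ∧
      entropy P Prod.snd ≤ W.utility P +
        (mutualInfo P Prod.fst Prod.snd + condEntropy P Prod.fst Prod.snd) ∧
      entropy P Prod.snd ≤ W.utility P +
        (mutualInfo P Prod.fst Prod.snd +
          (Real.log (mutualInfo P Prod.fst Prod.snd + 1) + 4)) := by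
  classical
  have hPid : (P.map fun ω => (ω.1, ω.2)) = P := PMF.map_id P
  set w : 𝒳 → ℝ := fun x => ((P.map Prod.fst) x).toReal with hw_def
  set q : 𝒴 → ℝ := fun y => ((P.map Prod.snd) y).toReal with hq_def
  -- Where `P_X` vanishes the conditional law is immaterial, but it has to be a probability law.
  let p : 𝒳 → 𝒴 → ℝ := fun x y => if w x = 0 then q y else (P (x, y)).toReal / w x
  have hw : ∀ x, 0 ≤ w x := fun x => ENNReal.toReal_nonneg
  have hr : ∀ x y, (P (x, y)).toReal ≤ w x := fun x y => by
    have := map_pair_le_fst P Prod.fst Prod.snd (x, y)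
    rwa [hPid] at this
  have hrs : ∀ x, ∑ y, (P (x, y)).toReal = w x := fun x => by
    have := sum_pair_right P Prod.fst Prod.snd x
    rwa [hPid] at this
  have hrq : ∀ y, ∑ x, (P (x, y)).toReal = q y := fun y => by
    have := sum_pair_left P Prod.fst Prod.snd y
    rwa [hPid] at this
  have hwp : ∀ x y, w x * p x y = (P (x, y)).toReal := by
    intro x y
    by_cases h : w x = 0
    · rw [h, zero_mul]
      exact (le_antisymm (h ▸ hr x y) ENNReal.toReal_nonneg).symm
    · simp only [p, if_neg h]
      field_simp
  have hp : ∀ x y, 0 ≤ p x y := by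
    intro x y
    by_cases h : w x = 0
    · simp only [p, if_pos h]
      exact ENNReal.toReal_nonneg
    · simp only [p, if_neg h]
      exact div_nonneg ENNReal.toReal_nonneg (hw x)
  have hp1 : ∀ x, ∑ y, p x y = 1 := by
    intro x
    by_cases h : w x = 0
    · simp only [p, if_pos h]
      exact sum_toReal _
    · simp only [p, if_neg h]
      rw [← Finset.sum_div, hrs, div_self h]
  set I := mutualInfo P Prod.fst Prod.snd with hI_def
  have hI0 : 0 ≤ I := mutualInfo_nonneg _ _ _
  have hI : I = ∑ x, ∑ y, w x * p x y * Real.log (p x y / q y) := by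
    rw [hI_def, mutualInfo, tsum_fintype, Fintype.sum_prod_type]
    refine Finset.sum_congr rfl fun x _ => Finset.sum_congr rfl fun y _ => ?_
    dsimp only
    rw [hPid, hwp]
    by_cases h : w x = 0
    · rw [← hwp, h]; simp
    · have hpx : p x y = (P (x, y)).toReal / w x := if_neg h
      rw [hpx, div_div]
  obtain ⟨Q, hQ, hQle⟩ := exists_random_function hw (sum_toReal _) hp hp1 (q := q)
    (fun y => by simp_rw [hwp]; exact (hrq y).symm) hI0 hI
  obtain ⟨W, e, hW⟩ := exists_mechanism_of_functionLaw P Q fun x y => by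
    rw [hQ, ← ENNReal.ofReal_toReal (PMF.apply_ne_top (P.map Prod.fst) x),
      ← ENNReal.ofReal_mul ENNReal.toReal_nonneg, ← ENNReal.ofReal_toReal (PMF.apply_ne_top P _),
      ← hwp]
  have hleak : W.leakage P = 0 := by
    have h := mutualInfo_equiv_right (functionLaw (P.map Prod.fst) Q) (fun ω => ω.1.1)
      (fun ω => ω.2) e
    rw [mutualInfo_functionLaw_fst] at h
    rw [Mechanism.leakage, hW, mutualInfo_map]
    exact h
  have hut : W.utility P = entropy P Prod.snd -
      ∑ g, (Q g).toReal * ∑ y, Real.negMulLog (pushMass w g y) := by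
    have h1 : (functionLaw (P.map Prod.fst) Q).map (fun ω => ω.1.2) = P.map Prod.snd := by
      rw [← joint_map_comp_fst W P Prod.snd, hW, PMF.map_comp]
      rfl
    have h := mutualInfo_equiv_right (functionLaw (P.map Prod.fst) Q) (fun ω => ω.1.2)
      (fun ω => ω.2) e
    rw [mutualInfo_functionLaw_snd, entropy, h1] at h
    rw [Mechanism.utility, Mechanism.infoAbout, hW, mutualInfo_map]
    exact h
  refine ⟨W, hleak, ?_, ?_⟩
  · rw [mutualInfo_add_condEntropy, hut]
    have h2 : ∑ g, (Q g).toReal * ∑ y, Real.negMulLog (pushMass w g y) ≤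
        entropy P Prod.fst := by
      calc _ ≤ ∑ g, (Q g).toReal * entropy P Prod.fst :=
            Finset.sum_le_sum fun g _ => mul_le_mul_of_nonneg_left
              (sum_negMulLog_pushMass_le hw g) ENNReal.toReal_nonneg
        _ = _ := by rw [← Finset.sum_mul, sum_toReal, one_mul]
    linarith
  · rw [hut]
    linarith

/-! ### The multi-component problem -/

theorem ereal_coe_sum {ι : Type*} (s : Finset ι) (f : ι → ℝ) :
    ((∑ i ∈ s, f i : ℝ) : EReal) = ∑ i ∈ s, (f i : EReal) := by
  classical
  induction s using Finset.induction_on with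
  | empty => simp
  | insert i s hi ih => rw [Finset.sum_insert hi, Finset.sum_insert hi, EReal.coe_add, ih]

section Components

variable {N K : ℕ} {𝒳 𝒴 : Fin N → Type*}

theorem sum_weight_mul (C : Fin K → Finset (Fin N)) (lam : Fin K → ℝ) (v : Fin N → ℝ) :
    ∑ i, weight C lam i * v i = ∑ k, lam k * ∑ j ∈ C k, v j := by
  simp only [weight, Finset.sum_filter, Finset.sum_mul, Finset.mul_sum, ite_mul, zero_mul]
  rw [Finset.sum_comm]
  simp [Finset.sum_ite_mem]

theorem weight_nonneg {C : Fin K → Finset (Fin N)} {lam : Fin K → ℝ} (hlam : ∀ k, 0 ≤ lam k)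
    (i : Fin N) : 0 ≤ weight C lam i :=
  Finset.sum_nonneg fun k _ => hlam k

variable [∀ i, Fintype (𝒳 i)] [∀ i, Fintype (𝒴 i)]

theorem leakage_nonneg {𝒳 𝒴 : Type*} [Finite 𝒳] (W : Mechanism 𝒳 𝒴) (P : PMF (𝒳 × 𝒴)) :
    0 ≤ W.leakage P := mutualInfo_nonneg _ _ _

/-- A family of mechanisms without leakage whose utilities fall short of `H(Y_i)` by at most both
gaps of the component `i`. -/
theorem exists_family_leakage_eq_zero (P : PMF ((∀ i, 𝒳 i) × (∀ i, 𝒴 i))) :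
    ∃ W : ∀ i, Mechanism (𝒳 i) (𝒴 i), ∀ i, (W i).leakage (marginal P i) = 0 ∧
      entropy P (fun xy => xy.2 i) ≤ (W i).utility (marginal P i) + gap₁ P i ∧
      entropy P (fun xy => xy.2 i) ≤ (W i).utility (marginal P i) + gap₂ P i := by
  choose W h0 h1 h2 using fun i => exists_mechanism_leakage_eq_zero (marginal P i)
  have hI : ∀ i, mutualInfo (marginal P i) Prod.fst Prod.snd = pairInfo P i := fun i =>
    mutualInfo_map P _ _ _
  have hC : ∀ i, condEntropy (marginal P i) Prod.fst Prod.snd =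
      condEntropy P (fun xy => xy.1 i) (fun xy => xy.2 i) := fun i => by
    simp only [condEntropy, marginal, PMF.map_comp]
    rfl
  have hH : ∀ i, entropy (marginal P i) Prod.snd = entropy P (fun xy => xy.2 i) := fun i => by
    simp only [entropy, marginal, PMF.map_comp]
    rfl
  refine ⟨W, fun i => ⟨h0 i, ?_, ?_⟩⟩
  · rw [gap₁, ← hI, ← hC, ← hH]
    exact h1 i
  · rw [gap₂, ← hI, ← hH]
    exact h2 i

omit [∀ i, Fintype (𝒳 i)] in
theorem infoAbout_restrict_le (P : PMF ((∀ i, 𝒳 i) × (∀ i, 𝒴 i)))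
    (W : Mechanism (∀ i, 𝒳 i) (∀ i, 𝒴 i)) (s : Finset (Fin N)) :
    W.infoAbout P (fun y => fun i : s => y i) ≤ ∑ j ∈ s, entropy P (fun xy => xy.2 j) := by
  refine (infoAbout_le_entropy W P fun y => fun i : s => y i).trans ?_
  refine (entropy_pi_le P fun (i : s) xy => xy.2 i).trans_eq ?_
  exact Finset.sum_coe_sort s fun j => entropy P fun xy => xy.2 j

omit [∀ i, Fintype (𝒳 i)] in
/-- Every mechanism discloses at most `∑_k λ_k ∑_{j ∈ C_k} H(Y_j)`. -/
theorem tradeoff_le (P : PMF ((∀ i, 𝒳 i) × (∀ i, 𝒴 i))) (C : Fin K → Finset (Fin N))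
    {lam : Fin K → ℝ} (hlam : ∀ k, 0 ≤ lam k) (ε : ℝ) :
    tradeoff P C lam ε ≤
      ((∑ k, lam k * ∑ j ∈ C k, entropy P (fun xy => xy.2 j) : ℝ) : EReal) :=
  iSup₂_le fun W _ => EReal.coe_le_coe_iff.2 <| Finset.sum_le_sum fun k _ =>
    mul_le_mul_of_nonneg_left (infoAbout_restrict_le P W (C k)) (hlam k)

theorem tradeoff_le_jointSup (P : PMF ((∀ i, 𝒳 i) × (∀ i, 𝒴 i))) (C : Fin K → Finset (Fin N))
    {lam : Fin K → ℝ} (hlam : ∀ k, 0 ≤ lam k) {ε : ℝ} (hε : 0 ≤ ε) :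
    tradeoff P C lam ε ≤ jointSup P C lam (compDelta P) ε := by
  obtain ⟨W, hW⟩ := exists_family_leakage_eq_zero P
  refine (tradeoff_le P C hlam ε).trans (le_iSup₂_of_le W ?_ (EReal.coe_le_coe_iff.2 ?_))
  · rw [Finset.sum_eq_zero fun i _ => (hW i).1]
    exact hε
  · rw [objective, sum_weight_mul]
    refine Finset.sum_le_sum fun k _ => mul_le_mul_of_nonneg_left ?_ (hlam k)
    refine Finset.sum_le_sum fun j _ => ?_
    rw [compDelta, ← min_add_add_left]
    exact le_min (hW j).2.1 (hW j).2.2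

theorem tradeoff_le_jointSup_add (P : PMF ((∀ i, 𝒳 i) × (∀ i, 𝒴 i)))
    (C : Fin K → Finset (Fin N)) {lam : Fin K → ℝ} (hlam : ∀ k, 0 ≤ lam k) {ε : ℝ}
    (hε : 0 ≤ ε) :
    tradeoff P C lam ε ≤
      jointSup P C lam 0 ε + ((∑ k, lam k * userDelta P (C k) : ℝ) : EReal) := by
  obtain ⟨W, hW⟩ := exists_family_leakage_eq_zero P
  have hle : ((objective P C lam 0 W : ℝ) : EReal) ≤ jointSup P C lam 0 ε := by
    refine le_iSup₂_of_le W ?_ le_rfl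
    rw [Finset.sum_eq_zero fun i _ => (hW i).1]
    exact hε
  refine (tradeoff_le P C hlam ε).trans (le_trans ?_ (add_le_add_left hle _))
  rw [← EReal.coe_add, EReal.coe_le_coe_iff, objective, sum_weight_mul, ← Finset.sum_add_distrib]
  refine Finset.sum_le_sum fun k _ => ?_
  rw [← mul_add]
  refine mul_le_mul_of_nonneg_left ?_ (hlam k)
  rw [userDelta, ← min_add_add_left]
  simp only [Pi.zero_apply, add_zero]
  rw [← Finset.sum_add_distrib, ← Finset.sum_add_distrib]
  exact le_min (Finset.sum_le_sum fun j _ => (hW j).2.1) (Finset.sum_le_sum fun j _ => (hW j).2.2)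

omit [∀ i, Fintype (𝒴 i)] in
/-- A family that meets the joint constraint meets the budget `e_i = I(X_i;U_i)`. -/
theorem jointSup_eq_budgetSup (P : PMF ((∀ i, 𝒳 i) × (∀ i, 𝒴 i))) (C : Fin K → Finset (Fin N))
    (lam : Fin K → ℝ) (d : Fin N → ℝ) (ε : ℝ) :
    jointSup P C lam d ε = budgetSup P C lam d ε := by
  refine le_antisymm (iSup₂_le fun W hW => ?_) (iSup₂_le fun e he => iSup₂_le fun W hW => ?_)
  · refine le_iSup₂_of_le (fun i => (W i).leakage (marginal P i)) ⟨fun i => ⟨?_, ?_⟩, hW⟩ ?_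
    · exact leakage_nonneg _ _
    · exact (Finset.single_le_sum (f := fun i => (W i).leakage (marginal P i))
        (fun i _ => leakage_nonneg _ _) (Finset.mem_univ i)).trans hW
    · exact le_iSup₂_of_le (f := fun W' (_ : ∀ i, (W' i).leakage (marginal P i) ≤
        (W i).leakage (marginal P i)) => ((objective P C lam d W' : ℝ) : EReal))
        W (fun i => le_rfl) le_rfl
  · exact le_iSup₂_of_le W ((Finset.sum_le_sum fun i _ => hW i).trans he.2) le_rfl

/-- The single-component supremum is finite. -/
theorem exists_singleSup_eq_coe {𝒳 𝒴 : Type*} [Fintype 𝒳] [Fintype 𝒴] (P : PMF (𝒳 × 𝒴)) {ε : ℝ}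
    (hε : 0 ≤ ε) : ∃ S : ℝ, singleSup P ε = S := by
  obtain ⟨W, hW, -⟩ := exists_mechanism_leakage_eq_zero P
  have h1 : singleSup P ε ≤ ((entropy P Prod.snd : ℝ) : EReal) :=
    iSup₂_le fun W _ => EReal.coe_le_coe_iff.2 (infoAbout_le_entropy W P id)
  have h2 : ((W.utility P : ℝ) : EReal) ≤ singleSup P ε :=
    le_iSup₂_of_le W (hW.trans_le hε) le_rfl
  exact ⟨_, (EReal.coe_toReal (ne_top_of_le_ne_top (EReal.coe_ne_top _) h1)
    (ne_bot_of_le_ne_bot (EReal.coe_ne_bot _) h2)).symm⟩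

/-- With fixed budgets the components can be optimized in parallel. -/
theorem fixedBudgetSup_eq_sum (P : PMF ((∀ i, 𝒳 i) × (∀ i, 𝒴 i))) (C : Fin K → Finset (Fin N))
    {lam : Fin K → ℝ} (hlam : ∀ k, 0 ≤ lam k) (d : Fin N → ℝ) {e : Fin N → ℝ}
    (he : ∀ i, 0 ≤ e i) :
    fixedBudgetSup P C lam d e = ∑ i, ((weight C lam i : ℝ) : EReal) *
      (singleSup (marginal P i) (e i) + ((d i : ℝ) : EReal)) := by
  choose S hS using fun i => exists_singleSup_eq_coe (marginal P i) (he i)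
  have hsum : ∑ i, ((weight C lam i : ℝ) : EReal) *
      (singleSup (marginal P i) (e i) + ((d i : ℝ) : EReal)) =
      ((∑ i, weight C lam i * (S i + d i) : ℝ) : EReal) := by
    rw [ereal_coe_sum]
    exact Finset.sum_congr rfl fun i _ => by rw [hS, EReal.coe_mul, EReal.coe_add]
  rw [hsum]
  have hup : fixedBudgetSup P C lam d e ≤ ((∑ i, weight C lam i * (S i + d i) : ℝ) : EReal) := by
    refine iSup₂_le fun W hW => EReal.coe_le_coe_iff.2 (Finset.sum_le_sum fun i _ =>
      mul_le_mul_of_nonneg_left (add_le_add_left ?_ _) (weight_nonneg hlam i))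
    rw [← EReal.coe_le_coe_iff, ← hS]
    exact le_iSup₂_of_le (W i) (hW i) le_rfl
  -- Families that are optimal up to `η` in every component lose at most `η ∑ μ_i`.
  have hlow : ∀ η : ℝ, 0 < η →
      ((∑ i, weight C lam i * (S i + d i) - (∑ i, weight C lam i) * η : ℝ) : EReal) ≤
        fixedBudgetSup P C lam d e := by
    intro η hη
    have hex : ∀ i, ∃ W : Mechanism (𝒳 i) (𝒴 i), W.leakage (marginal P i) ≤ e i ∧
        S i - η < W.utility (marginal P i) := by
      intro i
      have hlt : ((S i - η : ℝ) : EReal) < singleSup (marginal P i) (e i) := by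
        rw [hS, EReal.coe_lt_coe_iff]
        linarith
      obtain ⟨W, hW⟩ := lt_iSup_iff.1 hlt
      obtain ⟨hWe, hW⟩ := lt_iSup_iff.1 hW
      exact ⟨W, hWe, EReal.coe_lt_coe_iff.1 hW⟩
    choose W hWe hW using hex
    refine le_iSup₂_of_le W hWe (EReal.coe_le_coe_iff.2 ?_)
    rw [Finset.sum_mul, ← Finset.sum_sub_distrib]
    refine Finset.sum_le_sum fun i _ => ?_
    rw [← mul_sub]
    refine mul_le_mul_of_nonneg_left ?_ (weight_nonneg hlam i)
    linarith [hW i]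
  obtain ⟨F, hF⟩ : ∃ F : ℝ, fixedBudgetSup P C lam d e = F :=
    ⟨_, (EReal.coe_toReal (ne_top_of_le_ne_top (EReal.coe_ne_top _) hup)
      (ne_bot_of_le_ne_bot (EReal.coe_ne_bot _) (hlow 1 one_pos))).symm⟩
  refine le_antisymm hup ?_
  rw [hF, EReal.coe_le_coe_iff]
  have hμ : 0 ≤ ∑ i, weight C lam i := Finset.sum_nonneg fun i _ => weight_nonneg hlam i
  refine le_of_forall_pos_le_add fun δ hδ => ?_
  have h := hlow (δ / (∑ i, weight C lam i + 1)) (by positivity)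
  rw [hF, EReal.coe_le_coe_iff] at h
  have h2 : (∑ i, weight C lam i) * (δ / (∑ i, weight C lam i + 1)) ≤ δ := by
    rw [mul_div_assoc', div_le_iff₀ (by positivity)]
    nlinarith
  linarith

end Components

end

end PrivacyDesign

open PrivacyDesign in
theorem lemma5 {N K : ℕ} {𝒳 𝒴 : Fin N → Type*} [∀ i, Fintype (𝒳 i)] [∀ i, Fintype (𝒴 i)]
    (P : PMF ((∀ i, 𝒳 i) × (∀ i, 𝒴 i)))
    (hP : ∀ x y, P (x, y) = ∏ i, marginal P i (x i, y i))
    (C : Fin K → Finset (Fin N)) (lam : Fin K → ℝ) (hlam : ∀ k, 0 ≤ lam k)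
    (ε : ℝ) (hε : 0 ≤ ε) :
    tradeoff P C lam ε ≤ jointSup P C lam (compDelta P) ε ∧
    tradeoff P C lam ε ≤
      jointSup P C lam 0 ε + ((∑ k, lam k * userDelta P (C k) : ℝ) : EReal) ∧
    (∀ d : Fin N → ℝ, jointSup P C lam d ε = budgetSup P C lam d ε) ∧
    (∀ (d e : Fin N → ℝ), IsBudget ε e →
      fixedBudgetSup P C lam d e =
        ∑ i, ((weight C lam i : ℝ) : EReal) *
          (singleSup (marginal P i) (e i) + ((d i : ℝ) : EReal))) :=
  ⟨tradeoff_le_jointSup P C hlam hε, tradeoff_le_jointSup_add P C hlam hε,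
    fun d => jointSup_eq_budgetSup P C lam d ε,
    fun d _ he => fixedBudgetSup_eq_sum P C hlam d fun i => (he.1 i).1⟩
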